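/- **Covariant Noether theorem.** Let $X$ be a smooth manifold of dimension $n+1$ with a volume form $\mu$, and let $\pi:Y\to X$ be a smooth fibre bundle (or, more generally, a smooth submersion), with first jet bundle $J^1\pi$ and projections $\pi_{1,0}:J^1\pi\to Y$ and $\pi_1=\pi\circ\pi_{1,0}:J^1\pi\to X$. Let $L\in C^\infty(J^1\pi)$ be a Lagrangian. Its Cartan form and multisymplectic form are $$\Theta_L=\frac{\partial L}{\partial y^a_\mu}\,(dy^a-y^a_\nu\,dx^\nu)\wedge d^nx_\mu+L\,d^{n+1}x,\qquad \Omega_L=-d\Theta_L,$$ in coordinates $(x^\mu,y^a,y^a_\mu)$ on $J^1\pi$ induced by coordinates of $Y$ adapted to $\pi$ for which $\mu=d^{n+1}x=dx^1\wedge\dots\wedge dx^{n+1}$, where $d^nx_\mu=i_{\partial/\partial x^\mu}d^{n+1}x$. For a vector-valued one-form $\mathbf h$ on $J^1\pi$, let $i_{\mathbf h}$ be the derivation given by $$(i_{\mathbf h}\alpha)(v_0,\dots,v_k)=\sum_{i=0}^k(-1)^i\alpha(\mathbf h(v_i),v_0,\dots,\widehat{v_i},\dots,v_k)$$ on $(k+1)$-forms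 and by $0$ on functions, and let $d_{\mathbf h}=i_{\mathbf h}\circ d-d\circ i_{\mathbf h}$. Let $\mathbf h$ be the horizontal projector of a smooth connection on $\pi_1$, that is, a smooth vector-valued one-form with $\mathbf h\circ\mathbf h=\mathbf h$ whose kernel is the bundle of $\pi_1$-vertical vectors, and suppose that $\mathbf h$ solves the (unconstrained) De Donder–Weyl equation $$i_{\mathbf h}\Omega_L=n\,\Omega_L .$$ Let $G$ be a Lie group, with Lie algebra $\mathfrak g$, acting smoothly on $Y$ by bundle automorphisms $\Phi_g$ over the identity of $X$, and suppose that $L\circ j^1\Phi_g=L$ for all $g\in G$, where $j^1\Phi_g(j^1_x\phi)=j^1_x(\Phi_g\circ\phi)$. For $\xi\in\mathfrak g$ let $\xi^{(1)}$ be the infinitesimal generator on $J^1\pi$ of this prolonged action, and let $J_\xi=i_{\xi^{(1)}}\Theta_L$ be the covariant momentum map. Then for every $\xi\in\mathfrak g$ the momentum map $J_\xi$ is constant on integral sections of $\mathbf h$, in the sense that $$d_{\mathbf h}J_\xi=0 ;$$ moreover $d(\psi^*J_\xi)=0$ for every smooth local section $\psi$ of $\pi_1$, defined on an open subset of $X$,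 that is an integral section of $\mathbf h$ (i.e. $\mathbf h\circ T\psi=T\psi$). -/

import Mathlib

set_option maxSynthPendingDepth 3
set_option linter.unusedSectionVars false

open Set Manifold Filter
open scoped ContDiff Manifold Topology

/-! ### Exterior calculus on manifolds without boundary -/

section Forms

variable {V : Type*} [NormedAddCommGroup V] [NormedSpace ℝ V]
  {M : Type*} [TopologicalSpace M] [ChartedSpace V M]
  {W : Type*} [NormedAddCommGroup W] [NormedSpace ℝ W]
  {N : Type*} [TopologicalSpace N] [ChartedSpace W N]

/-- Differential `k`-forms on a manifold `M` modelled on `V`: an alternating `k`-linear form on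
each tangent space. (In Mathlib `TangentSpace 𝓘(ℝ, V) z` is by definition a copy of `V`.)
Smoothness is the separate predicate `DiffForm.IsSmooth`. -/
abbrev DiffForm (V : Type*) [NormedAddCommGroup V] [NormedSpace ℝ V] (M : Type*) (k : ℕ) :=
  M → V [⋀^Fin k]→L[ℝ] ℝ

/-- Vector-valued one-forms on `M`: an endomorphism of each tangent space. -/
abbrev VectorOneForm (V : Type*) [NormedAddCommGroup V] [NormedSpace ℝ V] (M : Type*) :=
  M → V →L[ℝ] V

namespace DiffForm

/-- The pullback `f^* α`. -/
noncomputable def pullback {k : ℕ} (f : M → N) (α : DiffForm W N k) : DiffForm V M k :=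
  fun x ↦ (α (f x)).compContinuousLinearMap
    (mfderiv 𝓘(ℝ, V) 𝓘(ℝ, W) f x : V →L[ℝ] W)

/-- A form is smooth if all its coordinate expressions are. -/
def IsSmooth {k : ℕ} (α : DiffForm V M k) : Prop :=
  ∀ x : M, ContDiffOn ℝ ∞ (pullback (chartAt V x).symm α : DiffForm V V k) (chartAt V x).target

/-- The exterior derivative: at `x`, write the form in the chart at `x`, take the exterior
derivative in the model space, and pull the result back to `M`. -/
noncomputable def d {k : ℕ} (α : DiffForm V M k) : DiffForm V M (k + 1) :=
  fun x ↦ pullback (chartAt V x)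
    (fun e ↦ extDeriv (pullback (chartAt V x).symm α : DiffForm V V k) e) x

/-- The contraction `i_v α` of a form with a vector field. -/
noncomputable def contract {k : ℕ} (v : M → V) (α : DiffForm V M (k + 1)) : DiffForm V M k :=
  fun z ↦ (α z).curryLeft (v z)

/-- The derivation `i_h` of degree zero of a vector-valued one-form `h`. It vanishes on functions,
and `(i_h α)(v₀, …, vₖ) = ∑ i, (-1) ^ i * α (h vᵢ, v₀, …, v̂ᵢ, …, vₖ)`
on `(k + 1)`-forms. -/
noncomputable def insertion (h : VectorOneForm V M) : {k : ℕ} → DiffForm V M k → DiffForm V M k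
  | 0, _ => 0
  | _ + 1, α => fun z ↦
      ContinuousAlternatingMap.alternatizeUncurryFin ((α z).curryLeft ∘L h z)

/-- The derivation `d_h = i_h ∘ d - d ∘ i_h`. -/
noncomputable def dVec (h : VectorOneForm V M) {k : ℕ} (α : DiffForm V M k) :
    DiffForm V M (k + 1) :=
  insertion h (d α) - d (insertion h α)

end DiffForm

end Forms

/-! ### First-order jets -/

section Jets

variable {E : Type*} [NormedAddCommGroup E] [NormedSpace ℝ E]
  {F : Type*} [NormedAddCommGroup F] [NormedSpace ℝ F]
  {X : Type*} [TopologicalSpace X] [ChartedSpace E X]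
  {Y : Type*} [TopologicalSpace Y] [ChartedSpace (E × F) Y]
  {π : Y → X}

/-- `T_y π`, for `Y` modelled on `E × F` and `X` modelled on `E`. -/
noncomputable abbrev projDeriv (π : Y → X) (y : Y) : E × F →L[ℝ] E :=
  mfderiv 𝓘(ℝ, E × F) 𝓘(ℝ, E) π y

/-- The first jet manifold `J¹π` of a submersion `π : Y → X`. A `1`-jet `j¹_x φ` of a
local section is the point `y = φ(x)` together with the linear map
`T_x φ : T_x X → T_y Y` (with `x = π y`), which is a right inverse of `T_y π`. -/
@[ext]
structure JetBundle (hπ : IsSubmersionOfComplement F 𝓘(ℝ, E × F) 𝓘(ℝ, E) ∞ π) where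
  /-- the target point `y = φ(x)` of the jet -/
  pt : Y
  /-- the linear map `T_x φ : T_x X → T_y Y` -/
  lin : E →L[ℝ] E × F
  proj_lin : projDeriv π pt ∘L lin = ContinuousLinearMap.id ℝ E

/-- The model space of `J¹π`, with coordinates `(x^μ, y^a, y^a_μ)`. -/
abbrev JetModel (E F : Type*) [NormedAddCommGroup E] [NormedSpace ℝ E] [NormedAddCommGroup F]
    [NormedSpace ℝ F] := (E × F) × (E →L[ℝ] F)

/-- A pair of charts of `Y` and of `X`, in the smooth structures of `Y` and `X`, for which `π` is
`(x, y) ↦ x`. -/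
structure AdaptedChart (π : Y → X) where
  total : OpenPartialHomeomorph Y (E × F)
  base : OpenPartialHomeomorph X E
  total_mem : total ∈ IsManifold.maximalAtlas 𝓘(ℝ, E × F) ∞ Y
  base_mem : base ∈ IsManifold.maximalAtlas 𝓘(ℝ, E) ∞ X
  mapsTo : ∀ y ∈ total.source, π y ∈ base.source
  fst_eq : ∀ y ∈ total.source, (total y).1 = base (π y)

theorem exists_adaptedChart [IsManifold 𝓘(ℝ, E × F) ∞ Y]
    (hπ : IsSubmersionOfComplement F 𝓘(ℝ, E × F) 𝓘(ℝ, E) ∞ π) (y : Y) :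
    ∃ c : AdaptedChart (E := E) (F := F) π, y ∈ c.total.source := by
  have hy := hπ y
  let t : OpenPartialHomeomorph Y (E × F) :=
    hy.domChart.trans hy.equiv.toHomeomorph.toOpenPartialHomeomorph
  have hsrc : t.source = hy.domChart.source := by simp [t]
  refine ⟨⟨t, hy.codChart, ?_, hy.codChart_mem_maximalAtlas, ?_, ?_⟩, ?_⟩
  · rw [IsManifold.mem_maximalAtlas_iff_contMDiffOn]
    constructor
    · have h1 := contMDiffOn_of_mem_maximalAtlas hy.domChart_mem_maximalAtlas
      rw [hsrc]
      exact hy.equiv.contDiff.contMDiff.comp_contMDiffOn h1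
    · have h1 := contMDiffOn_symm_of_mem_maximalAtlas hy.domChart_mem_maximalAtlas
      refine h1.comp hy.equiv.symm.contDiff.contMDiff.contMDiffOn ?_
      intro q hq
      simpa [t] using hq
  · intro y' hy'
    exact hy.source_subset_preimage_source (hsrc ▸ hy')
  · intro y' hy'
    rw [hsrc] at hy'
    have h1 : hy.domChart y' ∈ (hy.domChart.extend 𝓘(ℝ, E × F)).target := by
      simpa using hy.domChart.map_source hy'
    have h2 := hy.writtenInCharts h1
    simp only [OpenPartialHomeomorph.extend_coe, OpenPartialHomeomorph.extend_coe_symm,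
      modelWithCornersSelf_coe, modelWithCornersSelf_coe_symm, Function.comp_apply, id_eq,
      hy.domChart.left_inv hy'] at h2
    exact h2.symm
  · rw [hsrc]; exact hy.mem_domChart_source

namespace AdaptedChart

variable (c : AdaptedChart (E := E) (F := F) π)

theorem total_mdiff : c.total.MDifferentiable 𝓘(ℝ, E × F) 𝓘(ℝ, E × F) :=
  ⟨(contMDiffOn_of_mem_maximalAtlas c.total_mem).mdifferentiableOn (by simp),
    (contMDiffOn_symm_of_mem_maximalAtlas c.total_mem).mdifferentiableOn (by simp)⟩

theorem base_mdiff : c.base.MDifferentiable 𝓘(ℝ, E) 𝓘(ℝ, E) :=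
  ⟨(contMDiffOn_of_mem_maximalAtlas c.base_mem).mdifferentiableOn (by simp),
    (contMDiffOn_symm_of_mem_maximalAtlas c.base_mem).mdifferentiableOn (by simp)⟩

/-- The derivative of the chart of `Y`. -/
noncomputable abbrev dTotal (y : Y) : E × F →L[ℝ] E × F :=
  mfderiv 𝓘(ℝ, E × F) 𝓘(ℝ, E × F) c.total y

/-- The derivative of the inverse of the chart of `Y`. -/
noncomputable abbrev dTotalSymm (q : E × F) : E × F →L[ℝ] E × F :=
  mfderiv 𝓘(ℝ, E × F) 𝓘(ℝ, E × F) c.total.symm q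

/-- The derivative of the chart of `X`. -/
noncomputable abbrev dBase (x : X) : E →L[ℝ] E :=
  mfderiv 𝓘(ℝ, E) 𝓘(ℝ, E) c.base x

/-- The derivative of the inverse of the chart of `X`. -/
noncomputable abbrev dBaseSymm (q : E) : E →L[ℝ] E :=
  mfderiv 𝓘(ℝ, E) 𝓘(ℝ, E) c.base.symm q

theorem dTotalSymm_dTotal {y : Y} (hy : y ∈ c.total.source) :
    c.dTotalSymm (c.total y) ∘L c.dTotal y = ContinuousLinearMap.id ℝ (E × F) :=
  c.total_mdiff.symm_comp_deriv hy

theorem dTotal_dTotalSymm {y : Y} (hy : y ∈ c.total.source) :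
    c.dTotal y ∘L c.dTotalSymm (c.total y) = ContinuousLinearMap.id ℝ (E × F) := by
  have := c.total_mdiff.comp_symm_deriv (c.total.map_source hy)
  rw [c.total.left_inv hy] at this
  exact this

theorem dBaseSymm_dBase {x : X} (hx : x ∈ c.base.source) :
    c.dBaseSymm (c.base x) ∘L c.dBase x = ContinuousLinearMap.id ℝ E :=
  c.base_mdiff.symm_comp_deriv hx

theorem dBase_dBaseSymm {x : X} (hx : x ∈ c.base.source) :
    c.dBase x ∘L c.dBaseSymm (c.base x) = ContinuousLinearMap.id ℝ E := by
  have := c.base_mdiff.comp_symm_deriv (c.base.map_source hx)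
  rw [c.base.left_inv hx] at this
  exact this

theorem fst_dTotal (hd : MDifferentiable 𝓘(ℝ, E × F) 𝓘(ℝ, E) π) {y : Y}
    (hy : y ∈ c.total.source) :
    ContinuousLinearMap.fst ℝ E F ∘L c.dTotal y = c.dBase (π y) ∘L projDeriv π y := by
  have h1 : HasMFDerivAt 𝓘(ℝ, E × F) 𝓘(ℝ, E) (fun y ↦ (c.total y).1) y
      (ContinuousLinearMap.fst ℝ E F ∘L c.dTotal y) :=
    HasMFDerivAt.comp (I' := 𝓘(ℝ, E × F)) y
      ((ContinuousLinearMap.fst ℝ E F).hasFDerivAt.hasMFDerivAt)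
      (c.total_mdiff.mdifferentiableAt hy).hasMFDerivAt
  have h2 : HasMFDerivAt 𝓘(ℝ, E × F) 𝓘(ℝ, E) (c.base ∘ π) y
      (c.dBase (π y) ∘L projDeriv π y) :=
    HasMFDerivAt.comp (I' := 𝓘(ℝ, E)) y
      (c.base_mdiff.mdifferentiableAt (c.mapsTo y hy)).hasMFDerivAt (hd y).hasMFDerivAt
  have h3 : (c.base ∘ π) =ᶠ[𝓝 y] fun y ↦ (c.total y).1 := by
    filter_upwards [c.total.open_source.mem_nhds hy] with y' hy'
    exact (c.fst_eq y' hy').symm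
  exact hasMFDerivAt_unique h1 (h2.congr_of_eventuallyEq h3.symm)

end AdaptedChart

namespace JetBundle

variable {hπ : IsSubmersionOfComplement F 𝓘(ℝ, E × F) 𝓘(ℝ, E) ∞ π}

theorem mdifferentiable_proj [IsManifold 𝓘(ℝ, E) ∞ X] [IsManifold 𝓘(ℝ, E × F) ∞ Y]
    (hπ : IsSubmersionOfComplement F 𝓘(ℝ, E × F) 𝓘(ℝ, E) ∞ π) :
    MDifferentiable 𝓘(ℝ, E × F) 𝓘(ℝ, E) π :=
  hπ.contMDiff.mdifferentiable (by simp)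

/-- The fibre coordinates `(y^a_μ)` of a jet in an adapted chart. -/
noncomputable def fibreCoord (c : AdaptedChart (E := E) (F := F) π) (z : JetBundle hπ) :
    E →L[ℝ] F :=
  ContinuousLinearMap.snd ℝ E F ∘L c.dTotal z.pt ∘L z.lin ∘L c.dBaseSymm (c.base (π z.pt))

/-- The linear map `T_x X → T_y Y` with fibre coordinates `A` at the point `y` of `Y`. -/
noncomputable def linOfCoord (c : AdaptedChart (E := E) (F := F) π) (y : Y) (A : E →L[ℝ] F) :
    E →L[ℝ] E × F :=
  c.dTotalSymm (c.total y) ∘L (ContinuousLinearMap.id ℝ E).prod A ∘L c.dBase (π y)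

variable [IsManifold 𝓘(ℝ, E) ∞ X] [IsManifold 𝓘(ℝ, E × F) ∞ Y]

theorem proj_linOfCoord (hπ : IsSubmersionOfComplement F 𝓘(ℝ, E × F) 𝓘(ℝ, E) ∞ π)
    (c : AdaptedChart (E := E) (F := F) π) {y : Y} (hy : y ∈ c.total.source)
    (A : E →L[ℝ] F) :
    projDeriv π y ∘L linOfCoord c y A = ContinuousLinearMap.id ℝ E := by
  ext u
  have h1 := fun v ↦ DFunLike.congr_fun (c.fst_dTotal (mdifferentiable_proj hπ) hy) v
  have h2 := fun v ↦ DFunLike.congr_fun (c.dTotal_dTotalSymm hy) v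
  have h3 := fun v ↦ DFunLike.congr_fun (c.dBaseSymm_dBase (c.mapsTo y hy)) v
  simp only [ContinuousLinearMap.comp_apply, ContinuousLinearMap.id_apply,
    ContinuousLinearMap.coe_fst'] at h1 h2 h3
  simp only [linOfCoord, ContinuousLinearMap.comp_apply, ContinuousLinearMap.id_apply]
  rw [← h3 (projDeriv π y _), ← h1, h2]
  simp [h3]

theorem linOfCoord_fibreCoord (c : AdaptedChart (E := E) (F := F) π) (z : JetBundle hπ)
    (hz : z.pt ∈ c.total.source) : linOfCoord c z.pt (fibreCoord c z) = z.lin := by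
  ext1 u
  have h1 := fun v ↦ DFunLike.congr_fun (c.fst_dTotal (mdifferentiable_proj hπ) hz) v
  have h2 := fun v ↦ DFunLike.congr_fun (c.dTotalSymm_dTotal hz) v
  have h3 := fun v ↦ DFunLike.congr_fun (c.dBaseSymm_dBase (c.mapsTo _ hz)) v
  have h4 := fun v ↦ DFunLike.congr_fun z.proj_lin v
  simp only [ContinuousLinearMap.comp_apply, ContinuousLinearMap.id_apply,
    ContinuousLinearMap.coe_fst'] at h1 h2 h3 h4
  simp only [linOfCoord, fibreCoord, ContinuousLinearMap.comp_apply]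
  rw [← h2 (z.lin u)]
  congr 1
  refine Prod.ext ?_ ?_
  · simp [h1, h4]
  · simp [h3]

theorem fibreCoord_linOfCoord (c : AdaptedChart (E := E) (F := F) π) {y : Y}
    (hy : y ∈ c.total.source) (A : E →L[ℝ] F)
    (hA : projDeriv π y ∘L linOfCoord c y A = ContinuousLinearMap.id ℝ E) :
    fibreCoord c (⟨y, linOfCoord c y A, hA⟩ : JetBundle hπ) = A := by
  ext1 u
  have h2 := fun v ↦ DFunLike.congr_fun (c.dTotal_dTotalSymm hy) v
  have h3 := fun v ↦ DFunLike.congr_fun (c.dBase_dBaseSymm (c.mapsTo _ hy)) v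
  simp only [ContinuousLinearMap.comp_apply, ContinuousLinearMap.id_apply] at h2 h3
  simp [linOfCoord, fibreCoord, h2, h3]

open Classical in
/-- The coordinate system `(x^μ, y^a, y^a_μ)` on `J¹π` induced by an adapted chart. (The
hypothesis `Nonempty` only serves to give the inverse a value off the target of the chart.) -/
noncomputable def jetChart (c : AdaptedChart (E := E) (F := F) π) (hne : Nonempty (JetBundle hπ)) :
    PartialEquiv (JetBundle hπ) ((E × F) × (E →L[ℝ] F)) where
  toFun z := (c.total z.pt, fibreCoord c z)
  invFun p := if hp : p.1 ∈ c.total.target then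
      ⟨c.total.symm p.1, linOfCoord c (c.total.symm p.1) p.2,
        proj_linOfCoord hπ c (c.total.map_target hp) p.2⟩
    else Classical.choice hne
  source := {z | z.pt ∈ c.total.source}
  target := c.total.target ×ˢ univ
  map_source' z hz := ⟨c.total.map_source hz, mem_univ _⟩
  map_target' p hp := by
    have hp' : p.1 ∈ c.total.target := hp.1
    simpa [dif_pos hp'] using c.total.map_target hp'
  left_inv' z hz := by
    have hz' : z.pt ∈ c.total.source := hz
    rw [dif_pos (c.total.map_source hz')]
    apply JetBundle.ext
    · exact c.total.left_inv hz'
    · dsimp only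
      rw [c.total.left_inv hz']
      exact linOfCoord_fibreCoord c z hz'
  right_inv' p hp := by
    have hp' : p.1 ∈ c.total.target := hp.1
    rw [dif_pos hp']
    refine Prod.ext (c.total.right_inv hp') ?_
    exact fibreCoord_linOfCoord c (c.total.map_target hp') p.2 _

open Classical in
theorem jetChart_symm_pt (c : AdaptedChart (E := E) (F := F) π) (hne : Nonempty (JetBundle hπ))
    {p : (E × F) × (E →L[ℝ] F)} (hp : p.1 ∈ c.total.target) :
    ((jetChart c hne).symm p).pt = c.total.symm p.1 := by
  change (dite _ _ _ : JetBundle hπ).pt = _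
  rw [dif_pos hp]

open Classical in
theorem jetChart_symm_lin (c : AdaptedChart (E := E) (F := F) π) (hne : Nonempty (JetBundle hπ))
    {p : (E × F) × (E →L[ℝ] F)} (hp : p.1 ∈ c.total.target) :
    ((jetChart c hne).symm p).lin = linOfCoord c (c.total.symm p.1) p.2 := by
  change (dite _ _ _ : JetBundle hπ).lin = _
  rw [dif_pos hp]

theorem jetChart_trans_source (c c' : AdaptedChart (E := E) (F := F) π)
    (hne : Nonempty (JetBundle hπ)) :
    ((jetChart c hne).symm.trans (jetChart c' hne)).source =
      (c.total.symm.trans c'.total).source ×ˢ univ := by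
  ext p
  simp only [PartialEquiv.trans_source, PartialEquiv.symm_source, mem_inter_iff, mem_preimage,
    mem_prod, mem_univ, and_true, OpenPartialHomeomorph.trans_source,
    OpenPartialHomeomorph.symm_source]
  constructor
  · rintro ⟨h1, h2⟩
    have h1' : p.1 ∈ c.total.target := h1.1
    refine ⟨h1', ?_⟩
    have h2' : ((jetChart c hne).symm p).pt ∈ c'.total.source := h2
    rwa [jetChart_symm_pt c hne h1'] at h2'
  · rintro ⟨h1, h2⟩
    refine ⟨⟨h1, mem_univ _⟩, ?_⟩
    change ((jetChart c hne).symm p).pt ∈ c'.total.source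
    rwa [jetChart_symm_pt c hne h1]

theorem contDiffOn_total_trans (c c' : AdaptedChart (E := E) (F := F) π) :
    ContDiffOn ℝ ∞ (c.total.symm.trans c'.total) (c.total.symm.trans c'.total).source := by
  have := (contDiffGroupoid ∞ 𝓘(ℝ, E × F)).compatible_of_mem_maximalAtlas c.total_mem c'.total_mem
  exact contMDiffOn_iff_contDiffOn.1 (contMDiffOn_of_mem_contDiffGroupoid this)

theorem contDiffOn_base_trans (c c' : AdaptedChart (E := E) (F := F) π) :
    ContDiffOn ℝ ∞ (c.base.symm.trans c'.base) (c.base.symm.trans c'.base).source := by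
  have := (contDiffGroupoid ∞ 𝓘(ℝ, E)).compatible_of_mem_maximalAtlas c.base_mem c'.base_mem
  exact contMDiffOn_iff_contDiffOn.1 (contMDiffOn_of_mem_contDiffGroupoid this)

theorem jetChart_trans_eqOn (c c' : AdaptedChart (E := E) (F := F) π)
    (hne : Nonempty (JetBundle hπ)) :
    EqOn ((jetChart c hne).symm.trans (jetChart c' hne))
      (fun p ↦ ((c.total.symm.trans c'.total) p.1,
        ContinuousLinearMap.snd ℝ E F ∘L (fderiv ℝ (c.total.symm.trans c'.total) p.1) ∘L
          (ContinuousLinearMap.id ℝ E).prod p.2 ∘L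
          fderiv ℝ (c'.base.symm.trans c.base) ((c.total.symm.trans c'.total) p.1).1))
      ((c.total.symm.trans c'.total).source ×ˢ univ) := by
  rintro p ⟨hp, -⟩
  obtain ⟨hp1, hp2⟩ : p.1 ∈ c.total.target ∧ c.total.symm p.1 ∈ c'.total.source := by
    simpa using hp
  have hy : c.total.symm p.1 ∈ c.total.source := c.total.map_target hp1
  have e1 : fderiv ℝ (c.total.symm.trans c'.total) p.1 =
      c'.dTotal (c.total.symm p.1) ∘L c.dTotalSymm p.1 := by
    rw [← mfderiv_eq_fderiv]
    exact mfderiv_comp (I' := 𝓘(ℝ, E × F)) p.1 (c'.total_mdiff.mdifferentiableAt hp2)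
      (c.total_mdiff.mdifferentiableAt_symm hp1)
  have hb : (c'.total (c.total.symm p.1)).1 = c'.base (π (c.total.symm p.1)) := c'.fst_eq _ hp2
  have hx' := c'.mapsTo _ hp2
  have hx := c.mapsTo _ hy
  have e2 : fderiv ℝ (c'.base.symm.trans c.base) (c'.base (π (c.total.symm p.1))) =
      c.dBase (π (c.total.symm p.1)) ∘L c'.dBaseSymm (c'.base (π (c.total.symm p.1))) := by
    rw [← mfderiv_eq_fderiv]
    have hl := c'.base.left_inv hx'
    have := mfderiv_comp (I := 𝓘(ℝ, E)) (I' := 𝓘(ℝ, E)) (I'' := 𝓘(ℝ, E))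
      (g := c.base) (f := c'.base.symm) (c'.base (π (c.total.symm p.1)))
      (by rw [hl]; exact c.base_mdiff.mdifferentiableAt hx)
      (c'.base_mdiff.mdifferentiableAt_symm (c'.base.map_source hx'))
    rw [hl] at this
    exact this
  refine Prod.ext ?_ ?_
  · change c'.total ((jetChart c hne).symm p).pt = _
    rw [jetChart_symm_pt c hne hp1]; rfl
  · change fibreCoord c' ((jetChart c hne).symm p) = _
    simp only [fibreCoord, jetChart_symm_pt c hne hp1, jetChart_symm_lin c hne hp1, linOfCoord,
      OpenPartialHomeomorph.coe_trans, Function.comp_apply, hb, c.total.right_inv hp1] at e1 e2 ⊢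
    rw [e1, e2]
    rfl

theorem contDiffOn_jetChart_trans (c c' : AdaptedChart (E := E) (F := F) π)
    (hne : Nonempty (JetBundle hπ)) :
    ContDiffOn ℝ ∞ ((jetChart c hne).symm.trans (jetChart c' hne))
      ((jetChart c hne).symm.trans (jetChart c' hne)).source := by
  rw [jetChart_trans_source]
  refine ContDiffOn.congr ?_ (jetChart_trans_eqOn c c' hne)
  have hτ := contDiffOn_total_trans c c'
  have hfst : ContDiffOn ℝ ∞ (fun p : (E × F) × (E →L[ℝ] F) ↦ p.1)
      ((c.total.symm.trans c'.total).source ×ˢ univ) := contDiff_fst.contDiffOn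
  have hmaps : MapsTo (fun p : (E × F) × (E →L[ℝ] F) ↦ p.1)
      ((c.total.symm.trans c'.total).source ×ˢ univ) (c.total.symm.trans c'.total).source :=
    fun p hp ↦ hp.1
  have hτ1 := hτ.comp hfst hmaps
  have hdτ := (hτ.fderiv_of_isOpen (m := ∞) (c.total.symm.trans c'.total).open_source
    (by simp)).comp hfst hmaps
  have hdσ := (contDiffOn_base_trans c' c).fderiv_of_isOpen (m := ∞)
    (c'.base.symm.trans c.base).open_source (by simp)
  have hσ := hdσ.comp (contDiff_fst.comp_contDiffOn hτ1) (by
    rintro p ⟨hp, -⟩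
    obtain ⟨hp1, hp2⟩ : p.1 ∈ c.total.target ∧ c.total.symm p.1 ∈ c'.total.source := by
      simpa using hp
    have hb : (c'.total (c.total.symm p.1)).1 = c'.base (π (c.total.symm p.1)) := c'.fst_eq _ hp2
    have hx' := c'.mapsTo _ hp2
    have hx := c.mapsTo _ (c.total.map_target hp1)
    simp only [Function.comp_apply, OpenPartialHomeomorph.coe_trans, hb,
      OpenPartialHomeomorph.trans_source, OpenPartialHomeomorph.symm_source, mem_inter_iff,
      mem_preimage, c'.base.left_inv hx']
    exact ⟨c'.base.map_source hx', hx⟩)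
  have hprod : ContDiff ℝ ∞ (fun p : (E × F) × (E →L[ℝ] F) ↦
      (ContinuousLinearMap.id ℝ E).prod p.2) := by
    have h : (fun p : (E × F) × (E →L[ℝ] F) ↦ (ContinuousLinearMap.id ℝ E).prod p.2) =
        fun p ↦ ContinuousLinearMap.inl ℝ E F + ContinuousLinearMap.inr ℝ E F ∘L p.2 := by
      funext p; ext u <;> simp
    rw [h]
    exact contDiff_const.add (contDiff_const.clm_comp contDiff_snd)
  exact hτ1.prodMk (contDiffOn_const.clm_comp (hdτ.clm_comp (hprod.contDiffOn.clm_comp hσ)))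

/-- The atlas of `J¹π` given by the induced coordinates in all adapted charts. -/
noncomputable def chartedSpaceCore
    (hπ : IsSubmersionOfComplement F 𝓘(ℝ, E × F) 𝓘(ℝ, E) ∞ π) :
    ChartedSpaceCore ((E × F) × (E →L[ℝ] F)) (JetBundle hπ) where
  atlas := {e | ∃ (c : AdaptedChart (E := E) (F := F) π) (hne : Nonempty (JetBundle hπ)),
    e = jetChart c hne}
  chartAt z := jetChart (Classical.choose (exists_adaptedChart hπ z.pt)) ⟨z⟩
  mem_chart_source z := Classical.choose_spec (exists_adaptedChart hπ z.pt)
  chart_mem_atlas z := ⟨_, ⟨z⟩, rfl⟩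
  open_source := by
    rintro _ _ ⟨c, hne, rfl⟩ ⟨c', -, rfl⟩
    rw [jetChart_trans_source]
    exact (c.total.symm.trans c'.total).open_source.prod isOpen_univ
  continuousOn_toFun := by
    rintro _ _ ⟨c, hne, rfl⟩ ⟨c', -, rfl⟩
    exact (contDiffOn_jetChart_trans c c' hne).continuousOn

noncomputable instance : TopologicalSpace (JetBundle hπ) :=
  (chartedSpaceCore hπ).toTopologicalSpace

noncomputable instance : ChartedSpace ((E × F) × (E →L[ℝ] F)) (JetBundle hπ) :=
  (chartedSpaceCore hπ).toChartedSpace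

instance : IsManifold 𝓘(ℝ, (E × F) × (E →L[ℝ] F)) ∞ (JetBundle hπ) := by
  apply isManifold_of_contDiffOn
  intro e e' he he'
  obtain ⟨e₀, ⟨c, hne, rfl⟩, rfl⟩ := mem_iUnion₂.1 he
  obtain ⟨e₀', ⟨c', hne', rfl⟩, rfl⟩ := mem_iUnion₂.1 he'
  have := contDiffOn_jetChart_trans c c' hne
  rw [modelWithCornersSelf_coe, modelWithCornersSelf_coe_symm, Function.id_comp, Function.comp_id,
    preimage_id, range_id, inter_univ]
  exact this

/-! ### Lagrangian field theory on the jet bundle -/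

/-- `T π_{1,0}`, where `π_{1,0} : J¹π → Y`. -/
noncomputable abbrev targetDeriv (z : JetBundle hπ) : JetModel E F →L[ℝ] E × F :=
  mfderiv 𝓘(ℝ, JetModel E F) 𝓘(ℝ, E × F) (fun z : JetBundle hπ ↦ z.pt) z

/-- The projection `π₁ = π ∘ π_{1,0} : J¹π → X`. -/
def source (z : JetBundle hπ) : X := π z.pt

/-- `T π₁`. -/
noncomputable abbrev sourceDeriv (z : JetBundle hπ) : JetModel E F →L[ℝ] E :=
  mfderiv 𝓘(ℝ, JetModel E F) 𝓘(ℝ, E) (source : JetBundle hπ → X) z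

theorem proj_lin_apply (z : JetBundle hπ) (u : E) : projDeriv π z.pt (z.lin u) = u :=
  DFunLike.congr_fun z.proj_lin u

/-- The projection of `T_y Y = im γ ⊕ V_y π` onto the vertical space `V_y π = ker T_y π` along the
image of `γ`, for a jet `γ : T_x X → T_y Y`. -/
noncomputable def vertProj (z : JetBundle hπ) : E × F →L[ℝ] E × F :=
  ContinuousLinearMap.id ℝ (E × F) - z.lin ∘L projDeriv π z.pt

/-- The contact form `θ`, a one-form with values in the vertical bundle of `π`; in coordinates
`θ = (dy^a - y^a_ν dx^ν) ⊗ ∂/∂y^a`. -/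
noncomputable def contactForm (z : JetBundle hπ) : JetModel E F →L[ℝ] E × F :=
  vertProj z ∘L targetDeriv z

/-- The affine structure of the fibres of `π_{1,0}`: the jet `γ + β`, for a linear map
`β : T_x X → V_y π`. (A general `β : T_x X → T_y Y` is first projected to the
vertical space.) -/
noncomputable def translate (z : JetBundle hπ) (β : E →L[ℝ] E × F) : JetBundle hπ where
  pt := z.pt
  lin := z.lin + vertProj z ∘L β
  proj_lin := by
    ext u
    simp [vertProj, proj_lin_apply]

/-- The derivative of `L` along the fibre of `π_{1,0}`, i.e. the restriction of `dL` to the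
`π_{1,0}`-vertical vectors, `V π_{1,0} = T^*X ⊗ V π`. In coordinates it maps
`β = β^a_μ dx^μ ⊗ ∂/∂y^a` to `(∂L/∂y^a_μ) β^a_μ`. -/
noncomputable def fibreDeriv (L : JetBundle hπ → ℝ) (z : JetBundle hπ) :
    (E →L[ℝ] E × F) →L[ℝ] ℝ :=
  fderiv ℝ (fun β : E →L[ℝ] E × F ↦ L (translate z β)) 0

/-- The linear map which sends a tangent vector `v` of `J¹π` to the `n`-form
`(v₁, …, vₙ) ↦ (∂L/∂y^a_μ) θ^a(v) dⁿx_μ(v₁, …, vₙ)`, that is, to the value of the fibre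
derivative of `L` on `μ(·, Tπ₁ v₁, …, Tπ₁ vₙ) ⊗ θ(v)`. -/
noncomputable def momentumForm {n : ℕ} (μ : DiffForm E X (n + 1)) (L : JetBundle hπ → ℝ)
    (z : JetBundle hπ) : JetModel E F →L[ℝ] JetModel E F [⋀^Fin n]→L[ℝ] ℝ :=
  let φ : JetModel E F →L[ℝ] (E →L[ℝ] ℝ) →L[ℝ] ℝ :=
    ContinuousLinearMap.compL ℝ (E →L[ℝ] ℝ) (E →L[ℝ] E × F) ℝ (fibreDeriv L z) ∘L
      (ContinuousLinearMap.smulRightL ℝ E (E × F)).flip ∘L contactForm z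
  let α : JetModel E F [⋀^Fin n]→L[ℝ] (E →L[ℝ] ℝ) :=
    (μ (source z)).curryLeft.flipAlternating.compContinuousLinearMap (sourceDeriv z)
  let Λ : ((E →L[ℝ] ℝ) →L[ℝ] ℝ) →L[ℝ]
      (JetModel E F [⋀^Fin n]→L[ℝ] (E →L[ℝ] ℝ)) →L[ℝ] (JetModel E F [⋀^Fin n]→L[ℝ] ℝ) :=
    ContinuousLinearMap.compContinuousAlternatingMapCLM ℝ (JetModel E F) (E →L[ℝ] ℝ) ℝ (Fin n)
  Λ.flip α ∘L φ

theorem momentumForm_apply {n : ℕ} (μ : DiffForm E X (n + 1)) (L : JetBundle hπ → ℝ)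
    (z : JetBundle hπ) (v : JetModel E F) (w : Fin n → JetModel E F) :
    momentumForm μ L z v w = fibreDeriv L z
      (((μ (source z)).curryLeft.flipAlternating fun i ↦ sourceDeriv z (w i)).smulRight
        (contactForm z v)) :=
  rfl

/-- The Cartan form `Θ_L = L μ + (∂L/∂y^a_μ) θ^a ∧ dⁿx_μ`. -/
noncomputable def cartanForm {n : ℕ} (μ : DiffForm E X (n + 1)) (L : JetBundle hπ → ℝ) :
    DiffForm (JetModel E F) (JetBundle hπ) (n + 1) :=
  fun z ↦ L z • DiffForm.pullback source μ z +
    ContinuousAlternatingMap.alternatizeUncurryFin (momentumForm μ L z)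

/-- The multisymplectic form `Ω_L = -dΘ_L`. -/
noncomputable def multisymplecticForm {n : ℕ} (μ : DiffForm E X (n + 1)) (L : JetBundle hπ → ℝ) :
    DiffForm (JetModel E F) (JetBundle hπ) (n + 2) :=
  -DiffForm.d (cartanForm μ L)

/-- `h` is the horizontal projector of a (smooth) connection on `π₁`: a smooth vector-valued
one-form which is pointwise a projector with kernel the bundle of `π₁`-vertical vectors. -/
structure IsHorizontalProjector (h : VectorOneForm (JetModel E F) (JetBundle hπ)) : Prop where
  smooth : ContMDiff 𝓘(ℝ, JetModel E F)
    (𝓘(ℝ, JetModel E F).prod 𝓘(ℝ, JetModel E F →L[ℝ] JetModel E F)) ∞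
    (fun z ↦ Bundle.TotalSpace.mk' (JetModel E F →L[ℝ] JetModel E F)
      (E := fun z : JetBundle hπ ↦ TangentSpace 𝓘(ℝ, JetModel E F) z →L[ℝ]
        TangentSpace 𝓘(ℝ, JetModel E F) z) z (h z))
  idempotent : ∀ z, h z ∘L h z = h z
  ker_eq : ∀ z v, h z v = 0 ↔ sourceDeriv z v = 0

/-- The De Donder-Weyl equation `i_h Ω_L = n Ω_L`. -/
def SolvesDeDonderWeyl {n : ℕ} (μ : DiffForm E X (n + 1)) (L : JetBundle hπ → ℝ)
    (h : VectorOneForm (JetModel E F) (JetBundle hπ)) : Prop :=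
  DiffForm.insertion h (multisymplecticForm μ L) = (n : ℝ) • multisymplecticForm μ L

/-- `ψ` is, on the open set `U`, a smooth section of `π₁` which is an integral section of `h`:
its tangent spaces are horizontal. -/
structure IsIntegralSection (h : VectorOneForm (JetModel E F) (JetBundle hπ)) (U : Set X)
    (ψ : X → JetBundle hπ) : Prop where
  isOpen : IsOpen U
  smooth : ContMDiffOn 𝓘(ℝ, E) 𝓘(ℝ, JetModel E F) ∞ ψ U
  source_eq : ∀ x ∈ U, source (ψ x) = x
  horizontal : ∀ x ∈ U, ∀ u : E, h (ψ x) (mfderiv 𝓘(ℝ, E) 𝓘(ℝ, JetModel E F) ψ x u) =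
    mfderiv 𝓘(ℝ, E) 𝓘(ℝ, JetModel E F) ψ x u

/-- The prolongation `j¹Φ (j¹_x φ) = j¹_x (Φ ∘ φ)` of a smooth map `Φ : Y → Y` over the identity
of `X`. -/
noncomputable def prolong (Φ : Y → Y) (hΦ : ContMDiff 𝓘(ℝ, E × F) 𝓘(ℝ, E × F) ∞ Φ)
    (hcov : ∀ y, π (Φ y) = π y) (z : JetBundle hπ) : JetBundle hπ where
  pt := Φ z.pt
  lin := (mfderiv 𝓘(ℝ, E × F) 𝓘(ℝ, E × F) Φ z.pt : E × F →L[ℝ] E × F) ∘L z.lin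
  proj_lin := by
    have h := mfderiv_comp (I := 𝓘(ℝ, E × F)) (I' := 𝓘(ℝ, E × F)) (I'' := 𝓘(ℝ, E))
      (g := π) (f := Φ) z.pt (mdifferentiable_proj hπ _) (hΦ.mdifferentiable (by simp) _)
    have h' : π ∘ Φ = π := funext hcov
    rw [h'] at h
    have h2 := z.proj_lin
    rw [projDeriv, h] at h2
    exact h2

section Action

variable {EG : Type*} [NormedAddCommGroup EG] [NormedSpace ℝ EG]
  {G : Type*} [TopologicalSpace G] [ChartedSpace EG G] [Group G] [MulAction G Y]

/-- A smooth action of `G` on `Y` by bundle automorphisms over the identity of `X`. -/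
structure IsBundleAction (EG : Type*) [NormedAddCommGroup EG] [NormedSpace ℝ EG]
    (G : Type*) [TopologicalSpace G] [ChartedSpace EG G] [Group G] [MulAction G Y]
    (hπ : IsSubmersionOfComplement F 𝓘(ℝ, E × F) 𝓘(ℝ, E) ∞ π) : Prop where
  smooth : ContMDiff (𝓘(ℝ, EG).prod 𝓘(ℝ, E × F)) 𝓘(ℝ, E × F) ∞ (fun p : G × Y ↦ p.1 • p.2)
  proj_smul : ∀ (g : G) (y : Y), π (g • y) = π y

theorem IsBundleAction.smooth_smul (hG : IsBundleAction EG G hπ) (g : G) :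
    ContMDiff 𝓘(ℝ, E × F) 𝓘(ℝ, E × F) ∞ (fun y : Y ↦ g • y) :=
  hG.smooth.comp (contMDiff_const.prodMk contMDiff_id)

/-- The prolonged action of `G` on `J¹π`. -/
noncomputable def prolongedAction (hG : IsBundleAction EG G hπ) (g : G) (z : JetBundle hπ) :
    JetBundle hπ :=
  prolong (fun y : Y ↦ g • y) (hG.smooth_smul g) (hG.proj_smul g) z

/-- The infinitesimal generator `ξ^(1)` on `J¹π` of an element `ξ` of the Lie algebra: the
derivative at `g = 1`, in the direction `ξ`, of `g ↦ j¹Φ_g(z)`. -/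
noncomputable def generator (hG : IsBundleAction EG G hπ) (ξ : GroupLieAlgebra 𝓘(ℝ, EG) G)
    (z : JetBundle hπ) : JetModel E F :=
  mfderiv 𝓘(ℝ, EG) 𝓘(ℝ, JetModel E F) (fun g : G ↦ prolongedAction hG g z) 1 ξ

/-- The covariant momentum map `J_ξ = i_{ξ^(1)} Θ_L`. -/
noncomputable def momentumMap {n : ℕ} (μ : DiffForm E X (n + 1)) (L : JetBundle hπ → ℝ)
    (hG : IsBundleAction EG G hπ) (ξ : GroupLieAlgebra 𝓘(ℝ, EG) G) :
    DiffForm (JetModel E F) (JetBundle hπ) n :=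
  DiffForm.contract (generator hG ξ) (cartanForm μ L)

end Action

end JetBundle

end Jets

/-! ### Differentiability of form-valued maps -/

section Calculus

variable {S V : Type*} [NormedAddCommGroup S] [NormedSpace ℝ S]
  [NormedAddCommGroup V] [NormedSpace ℝ V]

/-! The Cartan form is assembled naturally from `L`, `μ` and the contact form. The action covers the
identity of `X`, so the prolonged action leaves `μ` and `Tπ₁` alone, carries the contact form along,
and preserves `L`, hence also its fibre derivative. So `Θ_L` is invariant
(`pullback_prolongedAction_cartanForm`), and Cartan's formula turns `0 = 𝓛_ξ Θ_L` into `dJ_ξ = i_ξ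
Ω_L` (`d_momentumMap`).

The generator `ξ^(1)` is `π₁`-vertical, so `h` kills it and `i_h` commutes with contraction by it
(`insertion_contract`). The De Donder-Weyl equation then gives `i_h dJ_ξ = i_ξ (i_h Ω_L) = n dJ_ξ`.
On the other hand `J_ξ` is an `n`-form which sees its arguments only through `Tπ₁`, and `Tπ₁ ∘ h =
Tπ₁`, so `i_h J_ξ = n J_ξ` (`insertion_eq_smul`). Subtracting `d (i_h J_ξ) = n dJ_ξ` from the first
identity yields `d_h J_ξ = 0`. Along an integral section `h` fixes all tangent vectors, so there
`i_h` multiplies the `(n + 1)`-form `dJ_ξ` by `n + 1` as well as by `n`; hence `ψ^* dJ_ξ = 0`, and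
`d_pullback` moves `d` outside.

Cartan's formula is obtained without flows (`extDeriv_curryLeft_of_invariant`): the invariant form
is pulled back by the whole family `(s, p) ↦ Ψ (s, p)` to the product of parameter space and
manifold, and `dΨ^*α = Ψ^*dα` is evaluated on one parameter direction and on vectors of the
manifold. It needs only a `C²` family through the identity, which the prolonged action provides in
induced coordinates once it is known to be jointly smooth (`contMDiff_prolongedAction`). -/

theorem ContinuousAlternatingMap.exists_clm_of_eval [FiniteDimensional ℝ V] (k : ℕ) :
    ∃ (m : ℕ) (w : Fin m → Fin k → V) (g : (Fin m → ℝ) →L[ℝ] V [⋀^Fin k]→L[ℝ] ℝ),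
      ∀ α : V [⋀^Fin k]→L[ℝ] ℝ, g (fun i ↦ α (w i)) = α := by
  let b := Module.finBasis ℝ V
  let e := Fintype.equivFin (Fin k → Fin (Module.finrank ℝ V))
  let w : Fin (Fintype.card (Fin k → Fin (Module.finrank ℝ V))) → Fin k → V :=
    fun i j ↦ b (e.symm i j)
  let T : (V [⋀^Fin k]→L[ℝ] ℝ) →ₗ[ℝ]
      (Fin (Fintype.card (Fin k → Fin (Module.finrank ℝ V))) → ℝ) :=
    { toFun := fun α i ↦ α (w i)
      map_add' := fun α β ↦ rfl
      map_smul' := fun r α ↦ rfl }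
  have hT : Function.Injective T := by
    intro α β hαβ
    apply ContinuousAlternatingMap.toAlternatingMap_injective
    refine Module.Basis.ext_alternating b fun v _ ↦ ?_
    have := congrFun hαβ (e v)
    simpa [T, w] using this
  -- Values on tuples of basis vectors determine a form, so evaluation has a linear left inverse,
  -- which is continuous because its domain `Fin m → ℝ` is finite-dimensional.
  obtain ⟨g, hg⟩ := T.exists_leftInverse_of_injective (LinearMap.ker_eq_bot.2 hT)
  exact ⟨_, w, LinearMap.toContinuousLinearMap g, fun α ↦ LinearMap.congr_fun hg α⟩

theorem differentiableAt_continuousAlternatingMap_of_apply [FiniteDimensional ℝ V] {k : ℕ}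
    {f : S → V [⋀^Fin k]→L[ℝ] ℝ} {x : S}
    (h : ∀ v, DifferentiableAt ℝ (fun y ↦ f y v) x) : DifferentiableAt ℝ f x := by
  obtain ⟨m, w, g, hg⟩ := ContinuousAlternatingMap.exists_clm_of_eval (V := V) k
  have : f = fun y ↦ g fun i ↦ f y (w i) := funext fun y ↦ (hg (f y)).symm
  rw [this]
  exact g.differentiableAt.comp x (differentiableAt_pi.2 fun i ↦ h (w i))

theorem DifferentiableAt.continuousAlternatingMap_curryLeft [FiniteDimensional ℝ V] {k : ℕ}
    {α : S → V [⋀^Fin (k + 1)]→L[ℝ] ℝ} {ξ : S → V} {x : S} (hα : DifferentiableAt ℝ α x)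
    (hξ : DifferentiableAt ℝ ξ x) :
    DifferentiableAt ℝ (fun p ↦ (α p).curryLeft (ξ p)) x := by
  refine differentiableAt_continuousAlternatingMap_of_apply fun v ↦ ?_
  refine (hα.hasFDerivAt.continuousAlternatingMap_apply
    (g := fun i p ↦ (Matrix.vecCons (ξ p) v : Fin (k + 1) → V) i) (g' := fun i ↦
      fderiv ℝ (fun p ↦ (Matrix.vecCons (ξ p) v : Fin (k + 1) → V) i) x)
    fun i ↦ DifferentiableAt.hasFDerivAt ?_).differentiableAt
  refine Fin.cases ?_ (fun j ↦ ?_) i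
  · simpa using hξ
  · simp

/-- Cartan's formula for a form which is invariant under a family of maps: if `Ψ (s₀, ·) = id` and
every `Ψ (s, ·)` preserves `α`, then `d (i_ξ α) = -i_ξ (d α)` for the infinitesimal generator `ξ`
of the family in a direction `a`. -/
theorem extDeriv_curryLeft_of_invariant [FiniteDimensional ℝ V] {k : ℕ}
    {α : V → V [⋀^Fin (k + 1)]→L[ℝ] ℝ} {Ψ : S × V → V} {s₀ : S} {p₀ : V}
    (hα : DifferentiableAt ℝ α p₀) (hΨ : ContDiffAt ℝ 2 Ψ (s₀, p₀))
    (hid : ∀ᶠ p in 𝓝 p₀, Ψ (s₀, p) = p)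
    (hinv : ∀ᶠ s in 𝓝 s₀, (α (Ψ (s, p₀))).compContinuousLinearMap
      (fderiv ℝ Ψ (s, p₀) ∘L ContinuousLinearMap.inr ℝ S V) = α p₀) (a : S) :
    DifferentiableAt ℝ (fun p ↦ (α p).curryLeft (fderiv ℝ Ψ (s₀, p) (a, 0))) p₀ ∧
    extDeriv (fun p ↦ (α p).curryLeft (fderiv ℝ Ψ (s₀, p) (a, 0))) p₀ =
      -(extDeriv α p₀).curryLeft (fderiv ℝ Ψ (s₀, p₀) (a, 0)) := by
  have hΨ0 : Ψ (s₀, p₀) = p₀ := hid.self_of_nhds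
  have hdΨ : DifferentiableAt ℝ (fderiv ℝ Ψ) (s₀, p₀) :=
    (hΨ.fderiv_right (m := 1) (by norm_num)).differentiableAt (by simp)
  have hincl : HasFDerivAt (fun p : V ↦ (s₀, p)) (ContinuousLinearMap.inr ℝ S V) p₀ :=
    hasFDerivAt_prodMk_right s₀ p₀
  have hincl' : HasFDerivAt (fun s : S ↦ (s, p₀)) (ContinuousLinearMap.inl ℝ S V) s₀ :=
    hasFDerivAt_prodMk_left s₀ p₀
  have hξ : DifferentiableAt ℝ (fun p ↦ fderiv ℝ Ψ (s₀, p) (a, 0)) p₀ :=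
    (DifferentiableAt.comp p₀ (g := fderiv ℝ Ψ) hdΨ hincl.differentiableAt).clm_apply
      (differentiableAt_const _)
  have hJ := hα.continuousAlternatingMap_curryLeft hξ
  refine ⟨hJ, ?_⟩
  -- Needed on a neighbourhood and not only at `p₀`, since the pulled-back form is differentiated in
  -- `p` below.
  have hev : ∀ᶠ p in 𝓝 p₀, ∀ v : V, fderiv ℝ Ψ (s₀, p) (0, v) = v := by
    have hd : ∀ᶠ p in 𝓝 p₀, DifferentiableAt ℝ Ψ (s₀, p) :=
      hincl.continuousAt.eventually
        ((hΨ.eventually (by simp)).mono fun q hq ↦ hq.differentiableAt (by simp))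
    filter_upwards [hd, hid.eventually_nhds] with p hp hp' v
    have h1 : HasFDerivAt (fun p ↦ Ψ (s₀, p))
        (fderiv ℝ Ψ (s₀, p) ∘L ContinuousLinearMap.inr ℝ S V) p :=
      HasFDerivAt.comp p (g := Ψ) hp.hasFDerivAt (hasFDerivAt_prodMk_right s₀ p)
    have h2 := h1.unique ((hasFDerivAt_id p).congr_of_eventuallyEq hp')
    simpa using DFunLike.congr_fun h2 v
  -- The pullback lives on `S × V`, so that the parameter direction `(a, 0)` and the vectors `(0, v
  -- i)` are arguments of one and the same form.
  have hpull := extDeriv_pullback (r := 2)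
    (show DifferentiableAt ℝ α (Ψ (s₀, p₀)) by rw [hΨ0]; exact hα) hΨ (by simp)
  have hB : DifferentiableAt ℝ
      (fun q ↦ (α (Ψ q)).compContinuousLinearMap (fderiv ℝ Ψ q)) (s₀, p₀) :=
    DifferentiableAt.continuousAlternatingMapCompContinuousLinearMap
      (DifferentiableAt.comp (s₀, p₀) (g := α) (by rw [hΨ0]; exact hα)
        (hΨ.differentiableAt (by simp))) hdΨ
  ext v
  have h := DFunLike.congr_fun hpull (Matrix.vecCons (a, 0) fun i ↦ (0, v i))
  rw [hΨ0, extDeriv_apply hB, Fin.sum_univ_succ] at h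
  -- The term of `dΨ^*α` differentiated along the parameter is the Lie derivative of `α`; it
  -- vanishes because `hinv` makes the function constant in `s`.
  have hfirst : fderiv ℝ (fun q ↦ ((α (Ψ q)).compContinuousLinearMap (fderiv ℝ Ψ q))
      fun i ↦ ((0 : S), v i)) (s₀, p₀) (a, 0) = 0 := by
    have h1 : HasFDerivAt (fun q ↦ ((α (Ψ q)).compContinuousLinearMap (fderiv ℝ Ψ q))
        fun i ↦ ((0 : S), v i)) _ (s₀, p₀) := DifferentiableAt.hasFDerivAt
      ((ContinuousAlternatingMap.apply ℝ (S × V) ℝ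
        (fun i ↦ ((0 : S), v i))).differentiableAt.comp _ hB)
    have h2 := HasFDerivAt.comp s₀ h1 hincl'
    have h3 : HasFDerivAt ((fun q ↦ ((α (Ψ q)).compContinuousLinearMap (fderiv ℝ Ψ q))
        fun i ↦ ((0 : S), v i)) ∘ fun s ↦ (s, p₀)) (0 : S →L[ℝ] ℝ) s₀ := by
      refine (hasFDerivAt_const (α p₀ v) s₀).congr_of_eventuallyEq ?_
      filter_upwards [hinv] with s hs
      rw [← hs]
      rfl
    simpa using DFunLike.congr_fun (h2.unique h3) a
  -- The remaining terms keep `(a, 0)` as first argument, and on the slice `s = s₀` the map `Ψ`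
  -- sends it to the generator. Up to sign these are the terms of `d (i_ξ α)`.
  have hrest (i : Fin (k + 1)) : fderiv ℝ (fun q ↦
      ((α (Ψ q)).compContinuousLinearMap (fderiv ℝ Ψ q))
      (Matrix.vecCons ((a : S), (0 : V)) (i.removeNth fun i ↦ ((0 : S), v i))))
        (s₀, p₀) (0, v i) =
      fderiv ℝ (fun p ↦ (α p).curryLeft (fderiv ℝ Ψ (s₀, p) (a, 0)) (i.removeNth v)) p₀ (v i) := by
    have h1 : HasFDerivAt (fun q ↦ ((α (Ψ q)).compContinuousLinearMap (fderiv ℝ Ψ q))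
        (Matrix.vecCons ((a : S), (0 : V)) (i.removeNth fun i ↦ ((0 : S), v i)))) _ (s₀, p₀) :=
      DifferentiableAt.hasFDerivAt
      ((ContinuousAlternatingMap.apply ℝ (S × V) ℝ _).differentiableAt.comp _ hB)
    have h2 := HasFDerivAt.comp p₀ h1 hincl
    have h3 : ((fun q ↦ ((α (Ψ q)).compContinuousLinearMap (fderiv ℝ Ψ q))
        (Matrix.vecCons ((a : S), (0 : V)) (i.removeNth fun i ↦ ((0 : S), v i)))) ∘
          fun p ↦ (s₀, p)) =ᶠ[𝓝 p₀]
        fun p ↦ (α p).curryLeft (fderiv ℝ Ψ (s₀, p) (a, 0)) (i.removeNth v) := by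
      filter_upwards [hev, hid] with p hp hp'
      simp only [Function.comp_apply, hp', ContinuousAlternatingMap.compContinuousLinearMap_apply,
        ContinuousAlternatingMap.curryLeft_apply_apply]
      congr 1
      funext j
      refine Fin.cases (by simp) (fun j ↦ ?_) j
      simp [Fin.removeNth, hp]
    rw [← h3.fderiv_eq, h2.fderiv]
    simp
  have hrhs : ((extDeriv α p₀).compContinuousLinearMap (fderiv ℝ Ψ (s₀, p₀)))
      (Matrix.vecCons (a, 0) fun i ↦ (0, v i)) =
      (extDeriv α p₀).curryLeft (fderiv ℝ Ψ (s₀, p₀) (a, 0)) v := by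
    simp only [ContinuousAlternatingMap.compContinuousLinearMap_apply,
        ContinuousAlternatingMap.curryLeft_apply_apply]
    congr 1
    funext j
    refine Fin.cases (by simp) (fun j ↦ ?_) j
    simp [hev.self_of_nhds]
  rw [hrhs] at h
  have e0 : Fin.removeNth 0 (Matrix.vecCons ((a : S), (0 : V)) fun i ↦ ((0 : S), v i)) =
      fun i ↦ (0, v i) := by
    funext j; simp [Fin.removeNth]
  have e1 (i : Fin (k + 1)) :
      Fin.removeNth i.succ (Matrix.vecCons ((a : S), (0 : V)) fun i ↦ ((0 : S), v i)) =
      Matrix.vecCons (a, 0) (i.removeNth fun i ↦ (0, v i)) := by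
    funext j
    refine Fin.cases ?_ (fun j ↦ ?_) j <;> simp [Fin.removeNth]
  -- The minus sign comes from the index shift: `v i` sits in slot `i + 1` of the longer tuple.
  rw [ContinuousAlternatingMap.neg_apply, ← h, extDeriv_apply hJ]
  simp only [e0, e1, Matrix.cons_val_zero, Matrix.cons_val_succ, hfirst, hrest, smul_zero,
    zero_add, Fin.val_succ, pow_succ, mul_neg, mul_one, neg_smul, Finset.sum_neg_distrib, neg_neg]

end Calculus

/-! ### Insertion of a vector-valued one-form -/

section Insertion

variable {V : Type*} [NormedAddCommGroup V] [NormedSpace ℝ V]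
  {M : Type*} [TopologicalSpace M] [ChartedSpace V M]

namespace DiffForm

/-- Moving `h (v i)` from the front back to slot `i` absorbs the sign `(-1) ^ i`, which makes the
derivation property visible: one argument is replaced at a time. -/
theorem insertion_apply (h : VectorOneForm V M) {k : ℕ} (α : DiffForm V M (k + 1)) (z : M)
    (v : Fin (k + 1) → V) :
    insertion h α z v = ∑ i, α z (Function.update v i (h z (v i))) := by
  simp only [insertion, ContinuousAlternatingMap.alternatizeUncurryFin_apply]
  refine Finset.sum_congr rfl fun i _ ↦ ?_
  rw [ContinuousLinearMap.comp_apply, ContinuousAlternatingMap.curryLeft_apply_apply,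
    ← ContinuousAlternatingMap.map_insertNth, Fin.insertNth_removeNth]

/-- The two sides differ only by the term in which `h` acts on `ξ`, and that term is zero. -/
theorem insertion_contract (h : VectorOneForm V M) (ξ : M → V) {k : ℕ}
    (α : DiffForm V M (k + 2)) {z : M} (hξ : h z (ξ z) = 0) :
    insertion h (contract ξ α) z = contract ξ (insertion h α) z := by
  ext v
  simp only [contract, ContinuousAlternatingMap.curryLeft_apply_apply, insertion_apply]
  rw [Fin.sum_univ_succ (n := k + 1)]
  have h0 : α z (Function.update (Matrix.vecCons (ξ z) v) 0
      (h z (Matrix.vecCons (ξ z) v 0))) = 0 :=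
    (α z).map_coord_zero 0 (by simp [hξ])
  rw [h0, zero_add]
  refine Finset.sum_congr rfl fun i _ ↦ ?_
  congr 1
  exact Fin.cons_update _ _ _ _

/-- If `α z` only depends on the image of its arguments under a map `T` with `T ∘ h = T`, then
`i_h α = k α` at `z`. -/
theorem insertion_eq_smul (h : VectorOneForm V M) {k : ℕ} (α : DiffForm V M k) {z : M}
    (hα : ∀ (v : Fin k → V) (i : Fin k), α z (Function.update v i (h z (v i))) = α z v) :
    insertion h α z = (k : ℝ) • α z := by
  cases k with
  -- On functions `insertion` is `0` by definition, in agreement with the factor `k = 0`. In the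
  -- main theorem this is the case `n = 0` of a one-dimensional base.
  | zero => simp [insertion]
  | succ k =>
    ext v
    rw [insertion_apply, Finset.sum_congr rfl fun i _ ↦ hα v i]
    simp

end DiffForm

end Insertion

/-! ### Naturality of the exterior derivative -/

section Naturality

variable {V : Type*} [NormedAddCommGroup V] [NormedSpace ℝ V]
  {M : Type*} [TopologicalSpace M] [ChartedSpace V M]
  {W : Type*} [NormedAddCommGroup W] [NormedSpace ℝ W]
  {N : Type*} [TopologicalSpace N] [ChartedSpace W N]
  {W' : Type*} [NormedAddCommGroup W'] [NormedSpace ℝ W']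
  {N' : Type*} [TopologicalSpace N'] [ChartedSpace W' N']

namespace DiffForm

theorem pullback_congr {k : ℕ} {f g : M → N} (α : DiffForm W N k) {x : M}
    (h : f =ᶠ[𝓝 x] g) : pullback (V := V) f α x = pullback (V := V) g α x := by
  simp only [pullback]
  rw [h.mfderiv_eq, h.self_of_nhds]

theorem pullback_comp {k : ℕ} {f : M → N} {g : N → N'} (α : DiffForm W' N' k) {x : M}
    (hg : MDifferentiableAt 𝓘(ℝ, W) 𝓘(ℝ, W') g (f x))
    (hf : MDifferentiableAt 𝓘(ℝ, V) 𝓘(ℝ, W) f x) :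
    pullback (V := V) (g ∘ f) α x = pullback (V := V) f (pullback (V := W) g α) x := by
  simp only [pullback]
  rw [mfderiv_comp (I' := 𝓘(ℝ, W)) x hg hf]
  rfl

theorem pullback_model {k : ℕ} (f : V → W) (α : DiffForm W W k) (x : V) :
    pullback f α x = (α (f x)).compContinuousLinearMap (fderiv ℝ f x) := by
  simp only [pullback, mfderiv_eq_fderiv]

/-- The chart is attached to a point `y` independent of `x`, so that one chart serves for all points
near a given one, as differentiation requires. -/
theorem pullback_eq_pullback_chart [IsManifold 𝓘(ℝ, W) ∞ N] {k : ℕ} {f : M → N}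
    (α : DiffForm W N k) {x : M} (hf : MDifferentiableAt 𝓘(ℝ, V) 𝓘(ℝ, W) f x) {y : N}
    (hy : f x ∈ (chartAt W y).source) :
    pullback (V := V) f α x =
      pullback (V := V) ((chartAt W y) ∘ f) (pullback (chartAt W y).symm α : DiffForm W W k) x := by
  have hχ := mdifferentiable_chart (I := 𝓘(ℝ, W)) y
  have h1 : f =ᶠ[𝓝 x] (chartAt W y).symm ∘ ((chartAt W y) ∘ f) := by
    filter_upwards [hf.continuousAt.preimage_mem_nhds ((chartAt W y).open_source.mem_nhds hy)]
      with x' hx'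
    exact ((chartAt W y).left_inv hx').symm
  rw [pullback_congr α h1]
  refine pullback_comp α ?_ ?_
  · exact hχ.mdifferentiableAt_symm ((chartAt W y).map_source hy)
  · exact (hχ.mdifferentiableAt hy).comp x hf

/-- `IsSmooth` speaks only of the preferred charts; this passes to other parametrizations, such as
the inverse of the base chart of an adapted pair. -/
theorem IsSmooth.differentiableAt_pullback [IsManifold 𝓘(ℝ, W) ∞ N] {k : ℕ}
    {α : DiffForm W N k} (hα : α.IsSmooth) {f : V → N} {U : Set V} (hU : IsOpen U)
    (hf : ContMDiffOn 𝓘(ℝ, V) 𝓘(ℝ, W) ∞ f U) {p : V} (hp : p ∈ U) :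
    DifferentiableAt ℝ (pullback f α : DiffForm V V k) p := by
  let χ := chartAt W (f p)
  have hO : IsOpen (U ∩ f ⁻¹' χ.source) :=
    hf.continuousOn.isOpen_inter_preimage hU χ.open_source
  have hpO : p ∈ U ∩ f ⁻¹' χ.source := ⟨hp, mem_chart_source W (f p)⟩
  have hg : ContDiffOn ℝ ∞ (χ ∘ f) (U ∩ f ⁻¹' χ.source) := by
    rw [← contMDiffOn_iff_contDiffOn]
    exact (contMDiffOn_chart (I := 𝓘(ℝ, W))).comp (hf.mono inter_subset_left) fun q hq ↦ hq.2
  have hga : ContDiffAt ℝ ∞ (χ ∘ f) p := hg.contDiffAt (hO.mem_nhds hpO)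
  have heq : (pullback f α : DiffForm V V k) =ᶠ[𝓝 p] fun q ↦
      ((pullback χ.symm α : DiffForm W W k) ((χ ∘ f) q)).compContinuousLinearMap
        (fderiv ℝ (χ ∘ f) q) := by
    filter_upwards [hO.mem_nhds hpO] with q hq
    rw [pullback_eq_pullback_chart α ((hf.contMDiffAt (hU.mem_nhds hq.1)).mdifferentiableAt
      (by simp)) hq.2, pullback_model]
  refine heq.differentiableAt_iff.2 ?_
  refine DifferentiableAt.continuousAlternatingMapCompContinuousLinearMap ?_ ?_
  · refine DifferentiableAt.comp (g := (pullback χ.symm α : DiffForm W W k)) (f := χ ∘ f) p ?_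
      (hga.differentiableAt (by simp))
    exact ((hα (f p)).contDiffAt (χ.open_target.mem_nhds
      (χ.map_source hpO.2))).differentiableAt (by simp)
  · exact (hga.fderiv_right (m := 1) (by norm_cast)).differentiableAt (by simp)

/-- The exterior derivative commutes with pullback. -/
theorem d_pullback [IsManifold 𝓘(ℝ, V) ∞ M] [IsManifold 𝓘(ℝ, W) ∞ N] {k : ℕ}
    {α : DiffForm W N k} {f : M → N} {U : Set M} (hU : IsOpen U)
    (hf : ContMDiffOn 𝓘(ℝ, V) 𝓘(ℝ, W) ∞ f U) {x : M} (hx : x ∈ U)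
    (hα : DifferentiableAt ℝ (pullback (chartAt W (f x)).symm α : DiffForm W W k)
      (chartAt W (f x) (f x))) :
    d (pullback (V := V) f α) x = pullback (V := V) f (d α) x := by
  let χ := chartAt V x
  let κ := chartAt W (f x)
  have hχ : χ.MDifferentiable 𝓘(ℝ, V) 𝓘(ℝ, V) := mdifferentiable_chart (I := 𝓘(ℝ, V)) x
  have hκ : κ.MDifferentiable 𝓘(ℝ, W) 𝓘(ℝ, W) := mdifferentiable_chart (I := 𝓘(ℝ, W)) (f x)
  have hxχ : x ∈ χ.source := mem_chart_source V x
  have hxκ : f x ∈ κ.source := mem_chart_source W (f x)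
  have hO : IsOpen (U ∩ f ⁻¹' κ.source) :=
    hf.continuousOn.isOpen_inter_preimage hU κ.open_source
  have hO' : IsOpen (χ.target ∩ χ.symm ⁻¹' (U ∩ f ⁻¹' κ.source)) :=
    χ.isOpen_inter_preimage_symm hO
  have hxO : χ x ∈ χ.target ∩ χ.symm ⁻¹' (U ∩ f ⁻¹' κ.source) := by
    refine ⟨χ.map_source hxχ, ?_⟩
    rw [mem_preimage, χ.left_inv hxχ]
    exact ⟨hx, hxκ⟩
  have hfd {q : M} (hq : q ∈ U) : MDifferentiableAt 𝓘(ℝ, V) 𝓘(ℝ, W) f q :=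
    (hf.contMDiffAt (hU.mem_nhds hq)).mdifferentiableAt (by simp)
  let g : V → W := κ ∘ f ∘ χ.symm
  have hg : ContDiffOn ℝ ∞ g (χ.target ∩ χ.symm ⁻¹' (U ∩ f ⁻¹' κ.source)) := by
    rw [← contMDiffOn_iff_contDiffOn]
    refine (contMDiffOn_chart (I := 𝓘(ℝ, W))).comp
      ((hf.mono inter_subset_left).comp
        ((contMDiffOn_chart_symm (I := 𝓘(ℝ, V)) (x := x)).mono inter_subset_left)
        fun q hq ↦ hq.2) fun q hq ↦ hq.2.2
  have hga : ContDiffAt ℝ ∞ g (χ x) := hg.contDiffAt (hO'.mem_nhds hxO)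
  have hgx : g (χ x) = κ (f x) := by simp [g, χ.left_inv hxχ]
  -- With `g` the expression of `f` in the charts at `x` and `f x`, this reduces the claim to the
  -- pullback formula in model spaces; `hd` below then exchanges the chart derivatives.
  have heq : (pullback χ.symm (pullback (V := V) f α) : DiffForm V V k) =ᶠ[𝓝 (χ x)] fun q ↦
      ((pullback κ.symm α : DiffForm W W k) (g q)).compContinuousLinearMap (fderiv ℝ g q) := by
    filter_upwards [hO'.mem_nhds hxO] with q hq
    have hχq := hχ.mdifferentiableAt_symm hq.1
    rw [← pullback_comp α (hfd hq.2.1) hχq, pullback_eq_pullback_chart (y := f x) α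
      ((hfd hq.2.1).comp q hχq) hq.2.2, pullback_model]
  have hd : fderiv ℝ g (χ x) ∘L (mfderiv 𝓘(ℝ, V) 𝓘(ℝ, V) χ x : V →L[ℝ] V) =
      (mfderiv 𝓘(ℝ, W) 𝓘(ℝ, W) κ (f x) : W →L[ℝ] W) ∘L
        (mfderiv 𝓘(ℝ, V) 𝓘(ℝ, W) f x : V →L[ℝ] W) := by
    have h1 := mfderiv_comp (I' := 𝓘(ℝ, V)) (I'' := 𝓘(ℝ, W)) (g := g) (f := χ) x
      (hga.differentiableAt (by simp)).mdifferentiableAt (hχ.mdifferentiableAt hxχ)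
    have h2 := mfderiv_comp (I' := 𝓘(ℝ, W)) (I'' := 𝓘(ℝ, W)) (g := κ) (f := f) x
      (hκ.mdifferentiableAt hxκ) (hfd hx)
    have h3 : g ∘ χ =ᶠ[𝓝 x] κ ∘ f := by
      filter_upwards [χ.open_source.mem_nhds hxχ] with q hq
      simp [g, χ.left_inv hq]
    rw [h3.mfderiv_eq, h2] at h1
    rw [mfderiv_eq_fderiv] at h1
    exact h1.symm
  have hext := extDeriv_pullback (r := 2) (show DifferentiableAt ℝ
    (pullback κ.symm α : DiffForm W W k) (g (χ x)) by rw [hgx]; exact hα)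
    (hga.of_le (by norm_cast)) (by simp)
  change (extDeriv (pullback χ.symm (pullback (V := V) f α) : DiffForm V V k)
    (χ x)).compContinuousLinearMap (mfderiv 𝓘(ℝ, V) 𝓘(ℝ, V) χ x : V →L[ℝ] V) = _
  rw [heq.extDeriv_eq, hext, hgx]
  change (extDeriv (pullback κ.symm α : DiffForm W W k) (κ (f x))).compContinuousLinearMap
    (fderiv ℝ g (χ x) ∘L (mfderiv 𝓘(ℝ, V) 𝓘(ℝ, V) χ x : V →L[ℝ] V)) = _
  rw [hd]
  rfl

theorem d_smul {k : ℕ} (r : ℝ) (α : DiffForm V M k) : d (r • α) = r • d α := by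
  funext x
  have h : (pullback (chartAt V x).symm (r • α) : DiffForm V V k) =
      r • pullback (chartAt V x).symm α := rfl
  simp only [d, h, pullback, extDeriv_smul]
  rfl

end DiffForm

end Naturality

/-! ### Coordinates on the jet bundle -/

section JetCoordinates

variable {E : Type*} [NormedAddCommGroup E] [NormedSpace ℝ E]
  {F : Type*} [NormedAddCommGroup F] [NormedSpace ℝ F]
  {X : Type*} [TopologicalSpace X] [ChartedSpace E X]
  {Y : Type*} [TopologicalSpace Y] [ChartedSpace (E × F) Y]
  {π : Y → X}
  {hπ : IsSubmersionOfComplement F 𝓘(ℝ, E × F) 𝓘(ℝ, E) ∞ π}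
  [IsManifold 𝓘(ℝ, E) ∞ X] [IsManifold 𝓘(ℝ, E × F) ∞ Y]

theorem AdaptedChart.projDeriv_dTotalSymm
    (hd : MDifferentiable 𝓘(ℝ, E × F) 𝓘(ℝ, E) π) (c : AdaptedChart (E := E) (F := F) π)
    {q : E × F} (hq : q ∈ c.total.target) (v : E × F) :
    projDeriv π (c.total.symm q) (c.dTotalSymm q v) = c.dBaseSymm q.1 v.1 := by
  have hy := c.total.map_target hq
  have h1 := DFunLike.congr_fun (c.fst_dTotal hd hy) (c.dTotalSymm q v)
  have h2 := DFunLike.congr_fun (c.dTotal_dTotalSymm hy) v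
  have h3 := DFunLike.congr_fun (c.dBaseSymm_dBase (c.mapsTo _ hy))
    (projDeriv π (c.total.symm q) (c.dTotalSymm q v))
  have h4 := c.fst_eq _ hy
  rw [c.total.right_inv hq] at h2 h4
  simp only [ContinuousLinearMap.comp_apply, ContinuousLinearMap.id_apply,
    ContinuousLinearMap.coe_fst'] at h1 h2 h3
  rw [← h3, ← h1, h2, h4]

namespace JetBundle

/-- The induced coordinate system of an adapted chart, as an open partial homeomorphism. -/
noncomputable def jetHomeo (c : AdaptedChart (E := E) (F := F) π)
    (hne : Nonempty (JetBundle hπ)) : OpenPartialHomeomorph (JetBundle hπ) (JetModel E F) :=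
  (chartedSpaceCore hπ).openPartialHomeomorph (jetChart c hne) ⟨c, hne, rfl⟩

theorem jetHomeo_apply (c : AdaptedChart (E := E) (F := F) π) (hne : Nonempty (JetBundle hπ))
    (z : JetBundle hπ) : jetHomeo c hne z = (c.total z.pt, fibreCoord c z) := rfl

theorem mem_jetHomeo_target {c : AdaptedChart (E := E) (F := F) π}
    {hne : Nonempty (JetBundle hπ)} {p : JetModel E F} :
    p ∈ (jetHomeo c hne).target ↔ p.1 ∈ c.total.target :=
  ⟨fun h ↦ h.1, fun h ↦ ⟨h, mem_univ _⟩⟩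

theorem jetHomeo_symm_pt (c : AdaptedChart (E := E) (F := F) π) (hne : Nonempty (JetBundle hπ))
    {p : JetModel E F} (hp : p.1 ∈ c.total.target) :
    ((jetHomeo c hne).symm p).pt = c.total.symm p.1 := jetChart_symm_pt c hne hp

theorem jetHomeo_mem_maximalAtlas (c : AdaptedChart (E := E) (F := F) π)
    (hne : Nonempty (JetBundle hπ)) :
    jetHomeo c hne ∈ IsManifold.maximalAtlas 𝓘(ℝ, JetModel E F) ∞ (JetBundle hπ) := by
  refine IsManifold.subset_maximalAtlas ?_
  exact mem_iUnion₂.2 ⟨jetChart c hne, ⟨c, hne, rfl⟩, rfl⟩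

/-- `DiffForm.d` is computed in the preferred chart, and this allows that chart to be taken as one
with coordinates `(x^μ, y^a, y^a_μ)`. -/
theorem exists_chartAt_eq_jetHomeo (z : JetBundle hπ) :
    ∃ (c : AdaptedChart (E := E) (F := F) π) (hne : Nonempty (JetBundle hπ)),
      chartAt (JetModel E F) z = jetHomeo c hne :=
  ⟨_, ⟨z⟩, rfl⟩

theorem contMDiffOn_jetHomeo (c : AdaptedChart (E := E) (F := F) π)
    (hne : Nonempty (JetBundle hπ)) :
    ContMDiffOn 𝓘(ℝ, JetModel E F) 𝓘(ℝ, JetModel E F) ∞ (jetHomeo c hne)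
      (jetHomeo c hne).source :=
  contMDiffOn_of_mem_maximalAtlas (jetHomeo_mem_maximalAtlas c hne)

theorem contMDiffOn_jetHomeo_symm (c : AdaptedChart (E := E) (F := F) π)
    (hne : Nonempty (JetBundle hπ)) :
    ContMDiffOn 𝓘(ℝ, JetModel E F) 𝓘(ℝ, JetModel E F) ∞ (jetHomeo c hne).symm
      (jetHomeo c hne).target :=
  contMDiffOn_symm_of_mem_maximalAtlas (jetHomeo_mem_maximalAtlas c hne)

theorem mdifferentiable_jetHomeo (c : AdaptedChart (E := E) (F := F) π)
    (hne : Nonempty (JetBundle hπ)) :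
    (jetHomeo c hne).MDifferentiable 𝓘(ℝ, JetModel E F) 𝓘(ℝ, JetModel E F) :=
  ⟨(contMDiffOn_jetHomeo c hne).mdifferentiableOn (by simp),
    (contMDiffOn_jetHomeo_symm c hne).mdifferentiableOn (by simp)⟩

theorem contMDiff_pt :
    ContMDiff 𝓘(ℝ, JetModel E F) 𝓘(ℝ, E × F) ∞ (fun z : JetBundle hπ ↦ z.pt) := by
  intro z
  obtain ⟨c, hc⟩ := exists_adaptedChart hπ z.pt
  have hs := contMDiffOn_symm_of_mem_maximalAtlas c.total_mem
  have hz : z ∈ (jetHomeo c ⟨z⟩).source := hc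
  have h : ContMDiffOn 𝓘(ℝ, JetModel E F) 𝓘(ℝ, E × F) ∞
      (c.total.symm ∘ Prod.fst ∘ jetHomeo (hπ := hπ) c ⟨z⟩) (jetHomeo c ⟨z⟩).source := by
    refine hs.comp ((contDiff_fst (E := E × F) (F := E →L[ℝ] F)).contMDiff.comp_contMDiffOn
      (contMDiffOn_jetHomeo c ⟨z⟩)) ?_
    intro z' hz'
    exact c.total.map_source hz'
  refine (h.congr fun z' hz' ↦ ?_).contMDiffAt ((jetHomeo c ⟨z⟩).open_source.mem_nhds hz)
  exact (c.total.left_inv hz').symm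

theorem contMDiff_source :
    ContMDiff 𝓘(ℝ, JetModel E F) 𝓘(ℝ, E) ∞ (source : JetBundle hπ → X) :=
  hπ.contMDiff.comp contMDiff_pt

theorem mdifferentiable_pt :
    MDifferentiable 𝓘(ℝ, JetModel E F) 𝓘(ℝ, E × F) (fun z : JetBundle hπ ↦ z.pt) :=
  contMDiff_pt.mdifferentiable (by simp)

theorem mdifferentiable_source :
    MDifferentiable 𝓘(ℝ, JetModel E F) 𝓘(ℝ, E) (source : JetBundle hπ → X) :=
  contMDiff_source.mdifferentiable (by simp)

theorem sourceDeriv_eq (z : JetBundle hπ) :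
    sourceDeriv z = projDeriv π z.pt ∘L targetDeriv z :=
  mfderiv_comp (I' := 𝓘(ℝ, E × F)) z (mdifferentiable_proj hπ _) (mdifferentiable_pt z)

/-- The derivative of the inverse of the induced coordinate system. -/
noncomputable abbrev dJetSymm (c : AdaptedChart (E := E) (F := F) π)
    (hne : Nonempty (JetBundle hπ)) (p : JetModel E F) : JetModel E F →L[ℝ] JetModel E F :=
  mfderiv 𝓘(ℝ, JetModel E F) 𝓘(ℝ, JetModel E F) (jetHomeo c hne).symm p

theorem targetDeriv_jetHomeo_symm (c : AdaptedChart (E := E) (F := F) π)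
    (hne : Nonempty (JetBundle hπ)) {p : JetModel E F} (hp : p.1 ∈ c.total.target)
    (v : JetModel E F) :
    targetDeriv ((jetHomeo c hne).symm p)
      (dJetSymm c hne p v) =
        c.dTotalSymm p.1 v.1 := by
  have hp' : p ∈ (jetHomeo c hne).target := mem_jetHomeo_target.2 hp
  have h1 := mfderiv_comp (I' := 𝓘(ℝ, JetModel E F)) p
    (g := fun z : JetBundle hπ ↦ z.pt) (mdifferentiable_pt _)
    ((mdifferentiable_jetHomeo c hne).mdifferentiableAt_symm hp')
  have h2 := mfderiv_comp (I := 𝓘(ℝ, JetModel E F)) (I' := 𝓘(ℝ, E × F)) (I'' := 𝓘(ℝ, E × F)) p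
    (g := c.total.symm) (f := Prod.fst)
    (c.total_mdiff.mdifferentiableAt_symm hp) differentiableAt_fst.mdifferentiableAt
  have h3 : (fun z : JetBundle hπ ↦ z.pt) ∘ (jetHomeo c hne).symm =ᶠ[𝓝 p]
      c.total.symm ∘ Prod.fst := by
    filter_upwards [(jetHomeo c hne).open_target.mem_nhds hp'] with p' hp'
    exact jetHomeo_symm_pt c hne hp'.1
  rw [h3.mfderiv_eq, h2] at h1
  have h4 := DFunLike.congr_fun h1 v
  rw [mfderiv_eq_fderiv (f := Prod.fst), fderiv_fst] at h4
  exact h4.symm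

theorem sourceDeriv_jetHomeo_symm (c : AdaptedChart (E := E) (F := F) π)
    (hne : Nonempty (JetBundle hπ)) {p : JetModel E F} (hp : p.1 ∈ c.total.target)
    (v : JetModel E F) :
    sourceDeriv ((jetHomeo c hne).symm p)
      (dJetSymm c hne p v) =
        c.dBaseSymm p.1.1 v.1.1 := by
  rw [sourceDeriv_eq, ContinuousLinearMap.comp_apply, targetDeriv_jetHomeo_symm c hne hp,
    jetHomeo_symm_pt c hne hp]
  exact c.projDeriv_dTotalSymm (mdifferentiable_proj hπ) hp _

theorem source_jetHomeo_symm (c : AdaptedChart (E := E) (F := F) π)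
    (hne : Nonempty (JetBundle hπ)) {p : JetModel E F} (hp : p.1 ∈ c.total.target) :
    source ((jetHomeo c hne).symm p) = c.base.symm p.1.1 := by
  have hy := c.total.map_target hp
  have h := c.fst_eq _ hy
  rw [c.total.right_inv hp] at h
  rw [source, jetHomeo_symm_pt c hne hp, h, c.base.left_inv (c.mapsTo _ hy)]

/-- In coordinates the image of a jet is the graph of its fibre coordinate `A`. -/
theorem dTotal_lin (c : AdaptedChart (E := E) (F := F) π) {z : JetBundle hπ}
    (hz : z.pt ∈ c.total.source) (u : E) :
    c.dTotal z.pt (z.lin u) = (c.dBase (π z.pt) u, fibreCoord c z (c.dBase (π z.pt) u)) := by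
  rw [← linOfCoord_fibreCoord c z hz]
  have h2 := fun v ↦ DFunLike.congr_fun (c.dTotal_dTotalSymm hz) v
  simp only [ContinuousLinearMap.comp_apply, ContinuousLinearMap.id_apply] at h2
  rw [linOfCoord, ContinuousLinearMap.comp_apply, h2]
  simp

/-- Projecting along the graph of `A` is `(u, f) ↦ (0, f - A u)`; this is where the coefficients
`dy^a - y^a_ν dx^ν` come from. -/
theorem dTotal_vertProj (c : AdaptedChart (E := E) (F := F) π) {z : JetBundle hπ}
    (hz : z.pt ∈ c.total.source) (w : E × F) :
    c.dTotal z.pt (vertProj z w) =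
      (0, (c.dTotal z.pt w).2 - fibreCoord c z (c.dTotal z.pt w).1) := by
  have h1 := DFunLike.congr_fun (c.fst_dTotal (mdifferentiable_proj hπ) hz) w
  simp only [ContinuousLinearMap.comp_apply, ContinuousLinearMap.coe_fst'] at h1
  simp only [vertProj, sub_apply, ContinuousLinearMap.id_apply, map_sub,
    ContinuousLinearMap.comp_apply, dTotal_lin c hz, ← h1]
  ext <;> simp

theorem vertProj_vertProj (z : JetBundle hπ) (w : E × F) :
    vertProj z (vertProj z w) = vertProj z w := by
  simp [vertProj, proj_lin_apply]

/-- The infinitesimal fibre coordinates of a linear map `β : T_x X → T_y Y`, in an adapted chart. -/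
noncomputable def fibreCoordDeriv (c : AdaptedChart (E := E) (F := F) π) (z : JetBundle hπ) :
    (E →L[ℝ] E × F) →L[ℝ] (E →L[ℝ] F) :=
  (ContinuousLinearMap.snd ℝ E F ∘L c.dTotal z.pt ∘L vertProj z).postcomp E ∘L
    (c.dBaseSymm (c.base (π z.pt))).precomp (E × F)

theorem fibreCoordDeriv_apply (c : AdaptedChart (E := E) (F := F) π) (z : JetBundle hπ)
    (β : E →L[ℝ] E × F) : fibreCoordDeriv c z β =
      (ContinuousLinearMap.snd ℝ E F ∘L c.dTotal z.pt ∘L vertProj z) ∘L β ∘L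
        c.dBaseSymm (c.base (π z.pt)) := rfl

/-- The fibre coordinate is linear in `lin` over a fixed point of `Y`, so the affine structure of
the fibres becomes vector addition in the chart. -/
theorem jetHomeo_translate (c : AdaptedChart (E := E) (F := F) π) (hne : Nonempty (JetBundle hπ))
    (z : JetBundle hπ) (β : E →L[ℝ] E × F) :
    jetHomeo c hne (translate z β) =
      jetHomeo c hne z + (0, fibreCoordDeriv c z β) := by
  rw [jetHomeo_apply, jetHomeo_apply, fibreCoordDeriv_apply]
  refine Prod.ext ?_ ?_
  · simp [translate]
  · ext u
    simp [translate, fibreCoord]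

/-- Identifies `fibreDeriv` with the partial derivatives `∂L/∂y^a_μ`, and guarantees that the
`fderiv` defining it is a true derivative. -/
theorem hasFDerivAt_translate (c : AdaptedChart (E := E) (F := F) π)
    (hne : Nonempty (JetBundle hπ)) {L : JetBundle hπ → ℝ} {z : JetBundle hπ}
    (hL : MDifferentiableAt 𝓘(ℝ, JetModel E F) 𝓘(ℝ, ℝ) L z)
    (hz : z.pt ∈ c.total.source) :
    HasFDerivAt (fun β : E →L[ℝ] E × F ↦ L (translate z β))
      (fderiv ℝ (L ∘ (jetHomeo c hne).symm) (jetHomeo c hne z) ∘L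
        ContinuousLinearMap.inr ℝ (E × F) (E →L[ℝ] F) ∘L fibreCoordDeriv c z) 0 := by
  have hz' : z ∈ (jetHomeo c hne).source := hz
  have h1 : DifferentiableAt ℝ (L ∘ (jetHomeo c hne).symm) (jetHomeo c hne z) := by
    rw [← mdifferentiableAt_iff_differentiableAt]
    refine MDifferentiableAt.comp (I' := 𝓘(ℝ, JetModel E F)) _ ?_
      ((mdifferentiable_jetHomeo c hne).mdifferentiableAt_symm
      ((jetHomeo c hne).map_source hz'))
    rwa [(jetHomeo c hne).left_inv hz']
  have h2 : HasFDerivAt (fun β : E →L[ℝ] E × F ↦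
      jetHomeo c hne z + ((0 : E × F), fibreCoordDeriv c z β))
      (ContinuousLinearMap.inr ℝ (E × F) (E →L[ℝ] F) ∘L fibreCoordDeriv c z) 0 :=
    (ContinuousLinearMap.inr ℝ (E × F) (E →L[ℝ] F) ∘L fibreCoordDeriv c z).hasFDerivAt.const_add _
  have h3 := HasFDerivAt.comp (g := L ∘ (jetHomeo c hne).symm)
    (g' := fderiv ℝ (L ∘ (jetHomeo c hne).symm) (jetHomeo c hne z)) 0
    (by rw [map_zero, Prod.mk_zero_zero, add_zero]; exact h1.hasFDerivAt) h2
  refine h3.congr_of_eventuallyEq (Eventually.of_forall fun β ↦ ?_)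
  have h4 : translate z β ∈ (jetHomeo c hne).source := hz
  simp only [Function.comp_apply]
  rw [← jetHomeo_translate, (jetHomeo c hne).left_inv h4]

end JetBundle

end JetCoordinates

/-! ### The prolonged action -/

section ProlongedAction

variable {E : Type*} [NormedAddCommGroup E] [NormedSpace ℝ E]
  {F : Type*} [NormedAddCommGroup F] [NormedSpace ℝ F]
  {X : Type*} [TopologicalSpace X] [ChartedSpace E X]
  {Y : Type*} [TopologicalSpace Y] [ChartedSpace (E × F) Y]
  {π : Y → X}
  {hπ : IsSubmersionOfComplement F 𝓘(ℝ, E × F) 𝓘(ℝ, E) ∞ π}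
  [IsManifold 𝓘(ℝ, E) ∞ X] [IsManifold 𝓘(ℝ, E × F) ∞ Y]
  {EG : Type*} [NormedAddCommGroup EG] [NormedSpace ℝ EG]
  {G : Type*} [TopologicalSpace G] [ChartedSpace EG G] [Group G] [MulAction G Y]

namespace JetBundle

/-- The tangent map of `y ↦ g • y`. -/
noncomputable abbrev smulDeriv (E F : Type*) [NormedAddCommGroup E] [NormedSpace ℝ E]
    [NormedAddCommGroup F] [NormedSpace ℝ F] {Y : Type*} [TopologicalSpace Y]
    [ChartedSpace (E × F) Y] {G : Type*} [Group G] [MulAction G Y] (g : G) (y : Y) :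
    E × F →L[ℝ] E × F :=
  mfderiv 𝓘(ℝ, E × F) 𝓘(ℝ, E × F) (fun y : Y ↦ g • y) y

/-- The coordinate expression of `(g, y) ↦ g • y`. -/
noncomputable def actionCoord (κ : OpenPartialHomeomorph G EG)
    (c c' : AdaptedChart (E := E) (F := F) π) (r : EG × (E × F)) : E × F :=
  c'.total (κ.symm r.1 • c.total.symm r.2)

/-- The domain of the coordinate expression of `(g, y) ↦ g • y`. -/
def actionCoordDomain (κ : OpenPartialHomeomorph G EG)
    (c c' : AdaptedChart (E := E) (F := F) π) : Set (EG × (E × F)) :=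
  (κ.target ×ˢ c.total.target) ∩
    (fun r ↦ κ.symm r.1 • c.total.symm r.2) ⁻¹' c'.total.source

section

variable [IsManifold 𝓘(ℝ, EG) ∞ G] {κ : OpenPartialHomeomorph G EG}
  (hκ : κ ∈ IsManifold.maximalAtlas 𝓘(ℝ, EG) ∞ G)
  (c c' : AdaptedChart (E := E) (F := F) π)

include hκ in
theorem contMDiffOn_symm_smul_symm (hG : IsBundleAction EG G hπ) :
    ContMDiffOn 𝓘(ℝ, EG × (E × F)) 𝓘(ℝ, E × F) ∞
      (fun r : EG × (E × F) ↦ κ.symm r.1 • c.total.symm r.2) (κ.target ×ˢ c.total.target) := by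
  have h1 : ContMDiffOn 𝓘(ℝ, EG × (E × F)) 𝓘(ℝ, EG) ∞ (fun r : EG × (E × F) ↦ κ.symm r.1)
      (κ.target ×ˢ c.total.target) :=
    (contMDiffOn_symm_of_mem_maximalAtlas hκ).comp
      (contDiff_fst (E := EG) (F := E × F)).contMDiff.contMDiffOn fun r hr ↦ hr.1
  have h2 : ContMDiffOn 𝓘(ℝ, EG × (E × F)) 𝓘(ℝ, E × F) ∞
      (fun r : EG × (E × F) ↦ c.total.symm r.2) (κ.target ×ˢ c.total.target) :=
    (contMDiffOn_symm_of_mem_maximalAtlas c.total_mem).comp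
      (contDiff_snd (E := EG) (F := E × F)).contMDiff.contMDiffOn fun r hr ↦ hr.2
  exact hG.smooth.comp_contMDiffOn (h1.prodMk h2)

include hκ in
theorem isOpen_actionCoordDomain (hG : IsBundleAction EG G hπ) :
    IsOpen (actionCoordDomain κ c c') :=
  (contMDiffOn_symm_smul_symm hκ c hG).continuousOn.isOpen_inter_preimage
    (κ.open_target.prod c.total.open_target) c'.total.open_source

include hκ in
theorem contDiffOn_actionCoord (hG : IsBundleAction EG G hπ) :
    ContDiffOn ℝ ∞ (actionCoord κ c c') (actionCoordDomain κ c c') := by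
  rw [← contMDiffOn_iff_contDiffOn]
  exact (contMDiffOn_of_mem_maximalAtlas c'.total_mem).comp
    ((contMDiffOn_symm_smul_symm hκ c hG).mono inter_subset_left) fun r hr ↦ hr.2

include hκ in
theorem fderiv_actionCoord (hG : IsBundleAction EG G hπ) {r : EG × (E × F)}
    (hr : r ∈ actionCoordDomain κ c c') (v : E × F) :
    fderiv ℝ (actionCoord κ c c') r (0, v) =
      c'.dTotal (κ.symm r.1 • c.total.symm r.2)
        (smulDeriv E F (κ.symm r.1) (c.total.symm r.2) (c.dTotalSymm r.2 v)) := by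
  obtain ⟨s, q⟩ := r
  have h0 := ((contDiffOn_actionCoord hκ c c' hG).contDiffAt
    ((isOpen_actionCoordDomain hκ c c' hG).mem_nhds hr)).differentiableAt (by simp)
  have h1 : HasFDerivAt (fun q ↦ actionCoord κ c c' (s, q))
      (fderiv ℝ (actionCoord κ c c') (s, q) ∘L ContinuousLinearMap.inr ℝ EG (E × F)) q :=
    h0.hasFDerivAt.comp q (hasFDerivAt_prodMk_right s q)
  have hs := (hG.smooth_smul (κ.symm s)).mdifferentiable (by simp) (c.total.symm q)
  have h2 := HasMFDerivAt.comp (I' := 𝓘(ℝ, E × F)) (I'' := 𝓘(ℝ, E × F)) q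
    (c'.total_mdiff.mdifferentiableAt hr.2).hasMFDerivAt
    (HasMFDerivAt.comp (I' := 𝓘(ℝ, E × F)) q hs.hasMFDerivAt
      (c.total_mdiff.mdifferentiableAt_symm hr.1.2).hasMFDerivAt)
  exact DFunLike.congr_fun (hasMFDerivAt_unique h1.hasMFDerivAt h2) v

/-- The coordinate expression of the prolonged action. -/
noncomputable def prolongCoord (κ : OpenPartialHomeomorph G EG)
    (c c' : AdaptedChart (E := E) (F := F) π) (r : EG × JetModel E F) : JetModel E F :=
  (actionCoord κ c c' (r.1, r.2.1),
    ContinuousLinearMap.snd ℝ E F ∘L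
      (fderiv ℝ (actionCoord κ c c') (r.1, r.2.1) ∘L ContinuousLinearMap.inr ℝ EG (E × F)) ∘L
      (ContinuousLinearMap.inl ℝ E F + ContinuousLinearMap.inr ℝ E F ∘L r.2.2) ∘L
      fderiv ℝ (c'.base.symm.trans c.base) (actionCoord κ c c' (r.1, r.2.1)).1)

/-- A point and its translate lie over the same point of `X`, so the base charts of `c` and `c'`
overlap there even when the two adapted charts are unrelated. -/
theorem mem_base_trans_source (hG : IsBundleAction EG G hπ) {r : EG × (E × F)}
    (hr : r ∈ actionCoordDomain κ c c') :
    (actionCoord κ c c' r).1 = c'.base (π (c.total.symm r.2)) ∧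
      π (c.total.symm r.2) ∈ c.base.source ∧ π (c.total.symm r.2) ∈ c'.base.source := by
  have h1 := c'.fst_eq _ hr.2
  have h2 := c'.mapsTo _ hr.2
  rw [hG.proj_smul] at h1 h2
  exact ⟨h1, c.mapsTo _ (c.total.map_target hr.1.2), h2⟩

include hκ in
-- The expression involves only the action in coordinates, first derivatives of it and of a base
-- transition map, and an affine function of the fibre coordinate.
theorem contDiffOn_prolongCoord (hG : IsBundleAction EG G hπ) :
    ContDiffOn ℝ ∞ (prolongCoord κ c c')
      ((fun r : EG × JetModel E F ↦ (r.1, r.2.1)) ⁻¹' actionCoordDomain κ c c') := by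
  have hτ := contDiffOn_actionCoord hκ c c' hG
  have hpr : ContDiffOn ℝ ∞ (fun r : EG × JetModel E F ↦ (r.1, r.2.1))
      ((fun r : EG × JetModel E F ↦ (r.1, r.2.1)) ⁻¹' actionCoordDomain κ c c') :=
    (contDiff_fst.prodMk (contDiff_fst.comp contDiff_snd)).contDiffOn
  have hτ1 := hτ.comp hpr fun r hr ↦ hr
  have hdτ := (hτ.fderiv_of_isOpen (m := ∞) (isOpen_actionCoordDomain hκ c c' hG)
    (by simp)).comp hpr fun r hr ↦ hr
  have hdσ := (contDiffOn_base_trans c' c).fderiv_of_isOpen (m := ∞)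
    (c'.base.symm.trans c.base).open_source (by simp)
  have hσ := hdσ.comp (contDiff_fst.comp_contDiffOn hτ1) (by
    intro r hr
    obtain ⟨h1, h2, h3⟩ := mem_base_trans_source c c' hG (mem_preimage.1 hr)
    simp only [Function.comp_apply, h1, OpenPartialHomeomorph.trans_source,
      OpenPartialHomeomorph.symm_source, mem_inter_iff, mem_preimage, c'.base.left_inv h3]
    exact ⟨c'.base.map_source h3, h2⟩)
  have hA : ContDiff ℝ ∞ (fun r : EG × JetModel E F ↦
      ContinuousLinearMap.inl ℝ E F + ContinuousLinearMap.inr ℝ E F ∘L r.2.2) :=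
    contDiff_const.add (contDiff_const.clm_comp (contDiff_snd.comp contDiff_snd))
  exact hτ1.prodMk (contDiffOn_const.clm_comp ((hdτ.clm_comp contDiffOn_const).clm_comp
    (hA.contDiffOn.clm_comp hσ)))

include hκ in
theorem jetHomeo_prolongedAction (hne : Nonempty (JetBundle hπ)) (hG : IsBundleAction EG G hπ)
    {g : G} (hg : g ∈ κ.source) {z : JetBundle hπ} (hz : z.pt ∈ c.total.source)
    (hgz : g • z.pt ∈ c'.total.source) :
    jetHomeo c' hne (prolongedAction hG g z) =
      prolongCoord κ c c' (κ g, jetHomeo c hne z) := by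
  have hr : (κ g, c.total z.pt) ∈ actionCoordDomain κ c c' := by
    refine ⟨⟨κ.map_source hg, c.total.map_source hz⟩, ?_⟩
    simpa [κ.left_inv hg, c.total.left_inv hz] using hgz
  obtain ⟨h1, h2, h3⟩ := mem_base_trans_source c c' hG hr
  have h4 := fderiv_actionCoord hκ c c' hG hr
  simp only [κ.left_inv hg, c.total.left_inv hz] at h1 h2 h3 h4
  have e2 : fderiv ℝ (c'.base.symm.trans c.base) (c'.base (π z.pt)) =
      c.dBase (π z.pt) ∘L c'.dBaseSymm (c'.base (π z.pt)) := by
    rw [← mfderiv_eq_fderiv]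
    have hl := c'.base.left_inv h3
    have := mfderiv_comp (I := 𝓘(ℝ, E)) (I' := 𝓘(ℝ, E)) (I'' := 𝓘(ℝ, E))
      (g := c.base) (f := c'.base.symm) (c'.base (π z.pt))
      (by rw [hl]; exact c.base_mdiff.mdifferentiableAt h2)
      (c'.base_mdiff.mdifferentiableAt_symm (c'.base.map_source h3))
    rw [hl] at this
    exact this
  rw [jetHomeo_apply, jetHomeo_apply, prolongCoord]
  refine Prod.ext ?_ ?_
  · simp [actionCoord, κ.left_inv hg, c.total.left_inv hz, prolongedAction, prolong]
  · ext1 u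
    simp only [ContinuousLinearMap.comp_apply, add_apply,
      ContinuousLinearMap.inl_apply, ContinuousLinearMap.inr_apply, h1, e2, Prod.mk_add_mk,
      add_zero, zero_add, h4]
    -- Rebuilding the jet from its coordinates turns both sides into the chain rule for `Tg ∘ γ`.
    have h5 := DFunLike.congr_fun (linOfCoord_fibreCoord c z hz)
      (c'.dBaseSymm (c'.base (π z.pt)) u)
    simp only [linOfCoord, ContinuousLinearMap.comp_apply, ContinuousLinearMap.prod_apply,
      ContinuousLinearMap.id_apply] at h5
    rw [h5]
    simp only [fibreCoord, prolongedAction, prolong, hG.proj_smul]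
    rfl

end

variable [IsManifold 𝓘(ℝ, EG) ∞ G]

/-- Joint smoothness gives both the differentiability of orbit maps, without which `generator` could
be a default value, and that of each prolonged map. -/
theorem contMDiff_prolongedAction (hG : IsBundleAction EG G hπ) :
    ContMDiff (𝓘(ℝ, EG).prod 𝓘(ℝ, JetModel E F)) 𝓘(ℝ, JetModel E F) ∞
      (fun r : G × JetBundle hπ ↦ prolongedAction hG r.1 r.2) := by
  rintro ⟨g₀, z₀⟩
  obtain ⟨c, hc⟩ := exists_adaptedChart hπ z₀.pt
  obtain ⟨c', hc'⟩ := exists_adaptedChart hπ (g₀ • z₀.pt)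
  let κ := chartAt EG g₀
  have hκ : κ ∈ IsManifold.maximalAtlas 𝓘(ℝ, EG) ∞ G := IsManifold.chart_mem_maximalAtlas g₀
  have hne : Nonempty (JetBundle hπ) := ⟨z₀⟩
  let O : Set (G × JetBundle hπ) := (κ.source ×ˢ (jetHomeo c hne).source) ∩
    (fun r : G × JetBundle hπ ↦ r.1 • r.2.pt) ⁻¹' c'.total.source
  have hcont : ContMDiff (𝓘(ℝ, EG).prod 𝓘(ℝ, JetModel E F)) 𝓘(ℝ, E × F) ∞
      (fun r : G × JetBundle hπ ↦ r.1 • r.2.pt) :=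
    hG.smooth.comp (contMDiff_fst.prodMk (contMDiff_pt.comp contMDiff_snd))
  have hO : IsOpen O := (κ.open_source.prod (jetHomeo c hne).open_source).inter
    (c'.total.open_source.preimage hcont.continuous)
  have h0 : (g₀, z₀) ∈ O := ⟨⟨mem_chart_source EG g₀, hc⟩, hc'⟩
  have h1 : ContMDiffOn (𝓘(ℝ, EG).prod 𝓘(ℝ, JetModel E F)) 𝓘(ℝ, EG × JetModel E F) ∞
      (fun r : G × JetBundle hπ ↦ (κ r.1, jetHomeo c hne r.2)) O := by
    refine ContMDiffOn.prodMk_space ?_ ?_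
    · exact (contMDiffOn_of_mem_maximalAtlas hκ).comp contMDiffOn_fst fun r hr ↦ hr.1.1
    · exact (contMDiffOn_jetHomeo c hne).comp contMDiffOn_snd fun r hr ↦ hr.1.2
  have h2 := (contDiffOn_prolongCoord hκ c c' hG).contMDiffOn.comp h1 (by
    rintro ⟨g, z⟩ ⟨⟨hg, hz⟩, hgz⟩
    refine ⟨⟨κ.map_source hg, c.total.map_source hz⟩, ?_⟩
    change κ.symm (κ g) • c.total.symm (c.total z.pt) ∈ c'.total.source
    rw [κ.left_inv hg, c.total.left_inv hz]
    exact hgz)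
  have h3 : ContMDiffOn (𝓘(ℝ, EG).prod 𝓘(ℝ, JetModel E F)) 𝓘(ℝ, JetModel E F) ∞
      (fun r : G × JetBundle hπ ↦ jetHomeo c' hne (prolongedAction hG r.1 r.2)) O :=
    h2.congr fun r hr ↦ jetHomeo_prolongedAction hκ c c' hne hG hr.1.1 hr.1.2 hr.2
  have h4 := (contMDiffOn_jetHomeo_symm c' hne).comp h3 fun r hr ↦
    (jetHomeo c' hne).map_source hr.2
  refine (h4.congr fun r hr ↦ ?_).contMDiffAt (hO.mem_nhds h0)
  exact ((jetHomeo c' hne).left_inv hr.2).symm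

end JetBundle

end ProlongedAction

/-! ### Invariance of the Cartan form -/

section Invariance

variable {E : Type*} [NormedAddCommGroup E] [NormedSpace ℝ E]
  {F : Type*} [NormedAddCommGroup F] [NormedSpace ℝ F]
  {X : Type*} [TopologicalSpace X] [ChartedSpace E X]
  {Y : Type*} [TopologicalSpace Y] [ChartedSpace (E × F) Y]
  {π : Y → X}
  {hπ : IsSubmersionOfComplement F 𝓘(ℝ, E × F) 𝓘(ℝ, E) ∞ π}
  [IsManifold 𝓘(ℝ, E) ∞ X] [IsManifold 𝓘(ℝ, E × F) ∞ Y]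
  {EG : Type*} [NormedAddCommGroup EG] [NormedSpace ℝ EG]
  {G : Type*} [TopologicalSpace G] [ChartedSpace EG G] [Group G] [MulAction G Y]

namespace JetBundle

theorem cartanForm_apply {n : ℕ} (μ : DiffForm E X (n + 1)) (L : JetBundle hπ → ℝ)
    (z : JetBundle hπ) (v : Fin (n + 1) → JetModel E F) :
    cartanForm μ L z v = L z * μ (source z) (fun i ↦ sourceDeriv z (v i)) +
      ∑ i : Fin (n + 1), (-1 : ℤ) ^ (i : ℕ) • momentumForm μ L z (v i) (i.removeNth v) := by
  rw [cartanForm, ContinuousAlternatingMap.add_apply,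
    ContinuousAlternatingMap.alternatizeUncurryFin_apply]
  rfl

/-- The last `n` slots are semibasic over `X`; together with verticality of the generator this makes
`J_ξ` semibasic. -/
theorem momentumForm_congr {n : ℕ} (μ : DiffForm E X (n + 1)) (L : JetBundle hπ → ℝ)
    {z : JetBundle hπ} (v : JetModel E F) {w w' : Fin n → JetModel E F}
    (h : ∀ i, sourceDeriv z (w i) = sourceDeriv z (w' i)) :
    momentumForm μ L z v w = momentumForm μ L z v w' := by
  rw [momentumForm_apply, momentumForm_apply, funext h]

/-- On `π₁`-vertical first arguments, the Cartan form is given by the momentum term alone. -/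
theorem cartanForm_cons_of_vertical {n : ℕ} (μ : DiffForm E X (n + 1)) (L : JetBundle hπ → ℝ)
    {z : JetBundle hπ} {ξ : JetModel E F} (hξ : sourceDeriv z ξ = 0)
    (v : Fin n → JetModel E F) :
    cartanForm μ L z (Matrix.vecCons ξ v) = momentumForm μ L z ξ v := by
  have h1 : μ (source z) (fun i ↦ sourceDeriv z (Matrix.vecCons ξ v i)) = 0 :=
    (μ (source z)).map_coord_zero 0 hξ
  -- In every term but the first, `ξ` remains among the semibasic arguments, where `Tπ₁` kills it.
  have h2 (i : Fin n) : momentumForm μ L z (Matrix.vecCons ξ v i.succ)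
      (i.succ.removeNth (Matrix.vecCons ξ v)) = 0 := by
    cases n with
    | zero => exact i.elim0
    | succ n =>
      have h3 : ((μ (source z)).curryLeft.flipAlternating fun j ↦
          sourceDeriv z (i.succ.removeNth (Matrix.vecCons ξ v) j)) = 0 :=
        ContinuousAlternatingMap.map_coord_zero _ 0 (by simpa [Fin.removeNth] using hξ)
      rw [momentumForm_apply, h3]
      have h4 (f : E × F) : (0 : E →L[ℝ] ℝ).smulRight f = 0 := by ext <;> simp
      rw [h4, map_zero]
  rw [cartanForm_apply, h1, Fin.sum_univ_succ, Finset.sum_eq_zero fun i _ ↦ by rw [h2, smul_zero]]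
  have h5 : Fin.removeNth 0 (Matrix.vecCons ξ v) = v := by
    funext j; simp [Fin.removeNth]
  simp [h5]

/-- The tangent map of the prolonged action of `g`. -/
noncomputable abbrev prolongDeriv (hG : IsBundleAction EG G hπ) (g : G) (z : JetBundle hπ) :
    JetModel E F →L[ℝ] JetModel E F :=
  mfderiv 𝓘(ℝ, JetModel E F) 𝓘(ℝ, JetModel E F) (prolongedAction hG g) z

theorem projDeriv_smulDeriv (hG : IsBundleAction EG G hπ) (g : G) (y : Y) (w : E × F) :
    projDeriv π (g • y) (smulDeriv E F g y w) = projDeriv π y w := by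
  have h := mfderiv_comp (I := 𝓘(ℝ, E × F)) (I' := 𝓘(ℝ, E × F)) (I'' := 𝓘(ℝ, E))
      (g := π) (f := fun y : Y ↦ g • y) y (mdifferentiable_proj hπ _)
      ((hG.smooth_smul g).mdifferentiable (by simp) _)
  have h' : (π ∘ fun y : Y ↦ g • y) = π := funext (hG.proj_smul g)
  rw [h'] at h
  exact (DFunLike.congr_fun h w).symm

/-- `Tg` maps the image of a jet onto the image of its prolongation and commutes with `Tπ`, so it
respects the two splittings of the tangent space. -/
theorem vertProj_smulDeriv (hG : IsBundleAction EG G hπ) (g : G) (z : JetBundle hπ) (w : E × F) :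
    vertProj (prolongedAction hG g z) (smulDeriv E F g z.pt w) =
      smulDeriv E F g z.pt (vertProj z w) := by
  have h := projDeriv_smulDeriv hG g z.pt w
  simp only [vertProj, sub_apply, ContinuousLinearMap.id_apply, map_sub,
    ContinuousLinearMap.comp_apply]
  change _ - smulDeriv E F g z.pt (z.lin (projDeriv π (g • z.pt) (smulDeriv E F g z.pt w))) = _
  rw [h]

theorem prolongedAction_one (hG : IsBundleAction EG G hπ) (z : JetBundle hπ) :
    prolongedAction hG 1 z = z := by
  apply JetBundle.ext
  · exact one_smul G z.pt
  · have h4 : (fun y : Y ↦ (1 : G) • y) = id := funext fun y ↦ one_smul G y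
    simp only [prolongedAction, prolong]
    rw [h4, mfderiv_id]
    rfl

/-- Prolongation is affine along the fibres of `π_{1,0}`, with linear part `β ↦ Tg ∘ β`. -/
theorem prolongedAction_translate (hG : IsBundleAction EG G hπ) (g : G) (z : JetBundle hπ)
    (β : E →L[ℝ] E × F) :
    prolongedAction hG g (translate z β) =
      translate (prolongedAction hG g z) (smulDeriv E F g z.pt ∘L β) := by
  apply JetBundle.ext
  · rfl
  · ext1 u
    change smulDeriv E F g z.pt (z.lin u + vertProj z (β u)) = smulDeriv E F g z.pt (z.lin u) +
      vertProj (prolongedAction hG g z) (smulDeriv E F g z.pt (β u))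
    rw [map_add, vertProj_smulDeriv]

/-- Differentiate the invariance of `L` along `β ↦ γ + β` at `β = 0`. -/
theorem fibreDeriv_prolongedAction (hG : IsBundleAction EG G hπ) {L : JetBundle hπ → ℝ}
    (hL : MDifferentiable 𝓘(ℝ, JetModel E F) 𝓘(ℝ, ℝ) L) (g : G)
    (hLg : ∀ z, L (prolongedAction hG g z) = L z) (z : JetBundle hπ) (β : E →L[ℝ] E × F) :
    fibreDeriv L (prolongedAction hG g z) (smulDeriv E F g z.pt ∘L β) = fibreDeriv L z β := by
  obtain ⟨c, hc⟩ := exists_adaptedChart hπ (prolongedAction hG g z).pt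
  have h1 := (hasFDerivAt_translate c ⟨z⟩ (hL _) hc).differentiableAt
  have h2 : HasFDerivAt (fun β : E →L[ℝ] E × F ↦ L (translate z β))
      (fibreDeriv L (prolongedAction hG g z) ∘L (smulDeriv E F g z.pt).postcomp E) 0 := by
    have h3 := HasFDerivAt.comp (0 : E →L[ℝ] E × F)
      (g := fun β : E →L[ℝ] E × F ↦ L (translate (prolongedAction hG g z) β))
      (by rw [map_zero]; exact h1.hasFDerivAt)
      ((smulDeriv E F g z.pt).postcomp E : (E →L[ℝ] E × F) →L[ℝ] (E →L[ℝ] E × F)).hasFDerivAt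
    refine h3.congr_of_eventuallyEq (Eventually.of_forall fun β ↦ ?_)
    exact (hLg _).symm.trans (congrArg L (prolongedAction_translate hG g z β))
  rw [fibreDeriv.eq_def L z, h2.fderiv]
  rfl

variable [IsManifold 𝓘(ℝ, EG) ∞ G]

theorem mdifferentiable_prolongedAction (hG : IsBundleAction EG G hπ) (g : G) :
    MDifferentiable 𝓘(ℝ, JetModel E F) 𝓘(ℝ, JetModel E F) (prolongedAction hG g) :=
  ((contMDiff_prolongedAction hG).comp
    (contMDiff_const.prodMk contMDiff_id)).mdifferentiable (by simp)

theorem mdifferentiable_orbit (hG : IsBundleAction EG G hπ) (z : JetBundle hπ) :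
    MDifferentiable 𝓘(ℝ, EG) 𝓘(ℝ, JetModel E F) (fun g : G ↦ prolongedAction hG g z) :=
  ((contMDiff_prolongedAction hG).comp
    (contMDiff_id.prodMk contMDiff_const)).mdifferentiable (by simp)

theorem targetDeriv_prolongDeriv (hG : IsBundleAction EG G hπ) (g : G) (z : JetBundle hπ)
    (v : JetModel E F) : targetDeriv (prolongedAction hG g z) (prolongDeriv hG g z v) =
      smulDeriv E F g z.pt (targetDeriv z v) := by
  have h1 := mfderiv_comp (I' := 𝓘(ℝ, JetModel E F)) z (g := fun z : JetBundle hπ ↦ z.pt)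
    (mdifferentiable_pt _) (mdifferentiable_prolongedAction hG g z)
  have h2 := mfderiv_comp (I' := 𝓘(ℝ, E × F)) (I'' := 𝓘(ℝ, E × F)) z
    (g := fun y : Y ↦ g • y) (f := fun z : JetBundle hπ ↦ z.pt)
    ((hG.smooth_smul g).mdifferentiable (by simp) _) (mdifferentiable_pt z)
  have h3 := h1.symm.trans h2
  exact DFunLike.congr_fun h3 v

theorem source_prolongedAction (hG : IsBundleAction EG G hπ) (g : G) (z : JetBundle hπ) :
    source (prolongedAction hG g z) = source z := hG.proj_smul g z.pt

theorem sourceDeriv_prolongDeriv (hG : IsBundleAction EG G hπ) (g : G) (z : JetBundle hπ)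
    (v : JetModel E F) : sourceDeriv (prolongedAction hG g z) (prolongDeriv hG g z v) =
      sourceDeriv z v := by
  have h1 := mfderiv_comp (I' := 𝓘(ℝ, JetModel E F)) z (g := (source : JetBundle hπ → X))
    (mdifferentiable_source _) (mdifferentiable_prolongedAction hG g z)
  have h2 : source ∘ prolongedAction hG g = (source : JetBundle hπ → X) :=
    funext (source_prolongedAction hG g)
  rw [h2] at h1
  exact (DFunLike.congr_fun h1 v).symm

theorem contactForm_prolongDeriv (hG : IsBundleAction EG G hπ) (g : G) (z : JetBundle hπ)
    (v : JetModel E F) : contactForm (prolongedAction hG g z) (prolongDeriv hG g z v) =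
      smulDeriv E F g z.pt (contactForm z v) := by
  change vertProj _ (targetDeriv (prolongedAction hG g z) (prolongDeriv hG g z v)) = _
  rw [targetDeriv_prolongDeriv, vertProj_smulDeriv]
  rfl

/-- The momentum term pairs the fibre derivative with a covector tensor the contact form. The
covector is unchanged because `μ` and `Tπ₁` are, and the factors `Tg` of the other two cancel. -/
theorem momentumForm_prolongDeriv (hG : IsBundleAction EG G hπ) {L : JetBundle hπ → ℝ}
    (hL : MDifferentiable 𝓘(ℝ, JetModel E F) 𝓘(ℝ, ℝ) L) (g : G)
    (hLg : ∀ z, L (prolongedAction hG g z) = L z) {n : ℕ} (μ : DiffForm E X (n + 1))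
    (z : JetBundle hπ) (v : JetModel E F) (w : Fin n → JetModel E F) :
    momentumForm μ L (prolongedAction hG g z) (prolongDeriv hG g z v)
      (fun i ↦ prolongDeriv hG g z (w i)) = momentumForm μ L z v w := by
  rw [momentumForm_apply, momentumForm_apply, contactForm_prolongDeriv,
    ← fibreDeriv_prolongedAction hG hL g hLg z, source_prolongedAction,
    funext fun i ↦ sourceDeriv_prolongDeriv hG g z (w i)]
  congr 1
  ext1 u
  exact (map_smul (smulDeriv E F g z.pt) _ _).symm

theorem pullback_prolongedAction_cartanForm (hG : IsBundleAction EG G hπ) {L : JetBundle hπ → ℝ}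
    (hL : MDifferentiable 𝓘(ℝ, JetModel E F) 𝓘(ℝ, ℝ) L) (g : G)
    (hLg : ∀ z, L (prolongedAction hG g z) = L z) {n : ℕ} (μ : DiffForm E X (n + 1)) :
    DiffForm.pullback (prolongedAction hG g) (cartanForm μ L) = cartanForm μ L := by
  funext z
  ext v
  change cartanForm μ L (prolongedAction hG g z) (fun i ↦ prolongDeriv hG g z (v i)) = _
  rw [cartanForm_apply, cartanForm_apply, hLg, source_prolongedAction,
    funext fun i ↦ sourceDeriv_prolongDeriv hG g z (v i)]
  congr 1
  refine Finset.sum_congr rfl fun i _ ↦ ?_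
  congr 1
  exact momentumForm_prolongDeriv hG hL g hLg μ z (v i) (i.removeNth v)

/-- Orbits of the prolonged action stay in one fibre of `π₁`. -/
theorem sourceDeriv_generator (hG : IsBundleAction EG G hπ) (ξ : GroupLieAlgebra 𝓘(ℝ, EG) G)
    (z : JetBundle hπ) : sourceDeriv z (generator hG ξ z) = 0 := by
  have h1 := mfderiv_comp (I' := 𝓘(ℝ, JetModel E F)) (1 : G) (g := (source : JetBundle hπ → X))
    (mdifferentiable_source _) (mdifferentiable_orbit hG z 1)
  have h2 : (source ∘ fun g : G ↦ prolongedAction hG g z) = fun _ ↦ source z :=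
    funext fun g ↦ source_prolongedAction hG g z
  rw [h2, mfderiv_const, prolongedAction_one] at h1
  exact (DFunLike.congr_fun h1 ξ).symm

end JetBundle

end Invariance

/-! ### The Noether identity -/

section Noether

variable {E : Type*} [NormedAddCommGroup E] [NormedSpace ℝ E]
  {F : Type*} [NormedAddCommGroup F] [NormedSpace ℝ F]
  {X : Type*} [TopologicalSpace X] [ChartedSpace E X]
  {Y : Type*} [TopologicalSpace Y] [ChartedSpace (E × F) Y]
  {π : Y → X}
  {hπ : IsSubmersionOfComplement F 𝓘(ℝ, E × F) 𝓘(ℝ, E) ∞ π}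
  [IsManifold 𝓘(ℝ, E) ∞ X] [IsManifold 𝓘(ℝ, E × F) ∞ Y]
  {EG : Type*} [NormedAddCommGroup EG] [NormedSpace ℝ EG]
  {G : Type*} [TopologicalSpace G] [ChartedSpace EG G] [Group G] [MulAction G Y]

namespace JetBundle

/-- The classical expression `(∂L/∂y^a_μ) (dy^a - y^a_ν dx^ν) ⊗ dⁿx_μ`, with a general `μ` in place
of `dⁿ⁺¹x`. -/
theorem momentumForm_jetHomeo_symm (c : AdaptedChart (E := E) (F := F) π)
    (hne : Nonempty (JetBundle hπ)) {n : ℕ} (μ : DiffForm E X (n + 1)) {L : JetBundle hπ → ℝ}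
    (hL : MDifferentiable 𝓘(ℝ, JetModel E F) 𝓘(ℝ, ℝ) L) {p : JetModel E F}
    (hp : p ∈ (jetHomeo c hne).target) (v : JetModel E F) (w : Fin n → JetModel E F) :
    momentumForm μ L ((jetHomeo c hne).symm p) (dJetSymm c hne p v)
      (fun i ↦ dJetSymm c hne p (w i)) =
    fderiv ℝ (L ∘ (jetHomeo c hne).symm) p (0,
      (((DiffForm.pullback c.base.symm μ : DiffForm E E (n + 1)) p.1.1).curryLeft.flipAlternating
        fun i ↦ (w i).1.1).smulRight (v.1.2 - p.2 v.1.1)) := by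
  have hp1 := mem_jetHomeo_target.1 hp
  have hz : ((jetHomeo c hne).symm p).pt ∈ c.total.source := (jetHomeo c hne).map_target hp
  have hχ := (jetHomeo c hne).right_inv hp
  have h1 : c.total ((jetHomeo c hne).symm p).pt = p.1 := congrArg Prod.fst hχ
  have h2 : fibreCoord c ((jetHomeo c hne).symm p) = p.2 := congrArg Prod.snd hχ
  have h3 := c.fst_eq _ hz
  rw [h1] at h3
  rw [momentumForm_apply, fibreDeriv, (hasFDerivAt_translate c hne (hL _) hz).fderiv, hχ,
    funext fun i ↦ sourceDeriv_jetHomeo_symm c hne hp1 (w i), source_jetHomeo_symm c hne hp1]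
  simp only [ContinuousLinearMap.comp_apply, ContinuousLinearMap.inr_apply, fibreCoordDeriv_apply,
    ← h3]
  congr 2
  -- `fibreCoordDeriv` projects to the vertical space once more, harmlessly, since the contact form
  -- already takes vertical values.
  have h5 : vertProj ((jetHomeo c hne).symm p)
      (contactForm ((jetHomeo c hne).symm p) (dJetSymm c hne p v)) =
      vertProj ((jetHomeo c hne).symm p) (c.dTotalSymm p.1 v.1) := by
    change vertProj _ (vertProj _ (targetDeriv _ (dJetSymm c hne p v))) = _
    rw [vertProj_vertProj, targetDeriv_jetHomeo_symm c hne hp1]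
  have h6 := dTotal_vertProj c hz (c.dTotalSymm p.1 v.1)
  have h7 := DFunLike.congr_fun (c.dTotal_dTotalSymm hz) v.1
  rw [h1] at h7
  simp only [ContinuousLinearMap.comp_apply, ContinuousLinearMap.id_apply] at h7
  rw [h7, h2] at h6
  ext1 u
  simp only [ContinuousLinearMap.comp_apply, ContinuousLinearMap.smulRight_apply, map_smul, h5, h6,
    ContinuousLinearMap.coe_snd']
  congr 1
  exact congrArg (μ (c.base.symm p.1.1)) (funext fun i ↦ Fin.cases rfl (fun i ↦ rfl) i)

/-- By finite dimension it suffices to evaluate on fixed vectors, where the coordinate formula is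
built from `L`, its derivative, `μ` and the fibre coordinate. -/
theorem differentiableAt_cartanForm [FiniteDimensional ℝ E] [FiniteDimensional ℝ F]
    (c : AdaptedChart (E := E) (F := F) π)
    (hne : Nonempty (JetBundle hπ)) {n : ℕ} {μ : DiffForm E X (n + 1)} (hμ : μ.IsSmooth)
    {L : JetBundle hπ → ℝ} (hL : ContMDiff 𝓘(ℝ, JetModel E F) 𝓘(ℝ, ℝ) ∞ L)
    {p : JetModel E F} (hp : p ∈ (jetHomeo c hne).target) :
    DifferentiableAt ℝ (DiffForm.pullback (jetHomeo c hne).symm (cartanForm μ L) :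
      DiffForm (JetModel E F) (JetModel E F) (n + 1)) p := by
  have hp1 := mem_jetHomeo_target.1 hp
  have hnhds := (jetHomeo c hne).open_target.mem_nhds hp
  have hLc : ContDiffAt ℝ ∞ (L ∘ (jetHomeo c hne).symm) p := by
    refine ContDiffOn.contDiffAt (s := (jetHomeo c hne).target) ?_ hnhds
    rw [← contMDiffOn_iff_contDiffOn]
    exact hL.comp_contMDiffOn (contMDiffOn_jetHomeo_symm c hne)
  have hb : p.1.1 ∈ c.base.target := by
    have h1 := c.total.map_target hp1
    have h2 := c.fst_eq _ h1
    rw [c.total.right_inv hp1] at h2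
    rw [h2]
    exact c.base.map_source (c.mapsTo _ h1)
  have hμb : DifferentiableAt ℝ (DiffForm.pullback c.base.symm μ : DiffForm E E (n + 1)) p.1.1 :=
    hμ.differentiableAt_pullback c.base.open_target
      (contMDiffOn_symm_of_mem_maximalAtlas c.base_mem) hb
  have hμp : DifferentiableAt ℝ (fun p : JetModel E F ↦
      (DiffForm.pullback c.base.symm μ : DiffForm E E (n + 1)) p.1.1) p :=
    DifferentiableAt.comp (f := fun p : JetModel E F ↦ p.1.1) p hμb differentiableAt_fst.fst
  refine differentiableAt_continuousAlternatingMap_of_apply fun v ↦ ?_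
  have hexpr : (fun q ↦ (DiffForm.pullback (jetHomeo c hne).symm (cartanForm μ L) :
      DiffForm (JetModel E F) (JetModel E F) (n + 1)) q v) =ᶠ[𝓝 p] fun q ↦
      (L ∘ (jetHomeo c hne).symm) q *
        (DiffForm.pullback c.base.symm μ : DiffForm E E (n + 1)) q.1.1 (fun i ↦ (v i).1.1) +
      ∑ i : Fin (n + 1), (-1 : ℤ) ^ (i : ℕ) • fderiv ℝ (L ∘ (jetHomeo c hne).symm) q (0,
        (((DiffForm.pullback c.base.symm μ : DiffForm E E (n + 1)) q.1.1).curryLeft.flipAlternating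
          fun j ↦ (i.removeNth v j).1.1).smulRight ((v i).1.2 - q.2 (v i).1.1)) := by
    filter_upwards [hnhds] with q hq
    have hq1 := mem_jetHomeo_target.1 hq
    change cartanForm μ L ((jetHomeo c hne).symm q) (fun i ↦ dJetSymm c hne q (v i)) = _
    rw [cartanForm_apply, funext fun i ↦ sourceDeriv_jetHomeo_symm c hne hq1 (v i),
      source_jetHomeo_symm c hne hq1]
    congr 1
    refine Finset.sum_congr rfl fun i _ ↦ ?_
    rw [← momentumForm_jetHomeo_symm c hne μ (hL.mdifferentiable (by simp)) hq]
    rfl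
  rw [hexpr.differentiableAt_iff]
  have hdL : DifferentiableAt ℝ (fderiv ℝ (L ∘ (jetHomeo c hne).symm)) p :=
    (hLc.fderiv_right (m := 1) (by norm_cast)).differentiableAt (by simp)
  refine ((hLc.differentiableAt (by simp)).mul
    ((ContinuousAlternatingMap.apply ℝ E ℝ _).differentiableAt.comp p hμp)).add ?_
  refine DifferentiableAt.fun_sum fun i _ ↦ ?_
  simp only [zsmul_eq_mul]
  refine (differentiableAt_const _).mul ?_
  refine hdL.clm_apply ((differentiableAt_const _).prodMk ?_)
  have hφ : DifferentiableAt ℝ (fun q : JetModel E F ↦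
      ((DiffForm.pullback c.base.symm μ : DiffForm E E (n + 1)) q.1.1).curryLeft.flipAlternating
          fun j ↦ (i.removeNth v j).1.1) p := by
    have h1 : DifferentiableAt ℝ (fun q : JetModel E F ↦
        ((DiffForm.pullback c.base.symm μ : DiffForm E E (n + 1)) q.1.1).curryLeft) p :=
      (ContinuousAlternatingMap.curryLeftLI (𝕜 := ℝ) (E := E) (F := ℝ)
        (n := n)).toContinuousLinearMap.differentiableAt.comp p hμp
    exact ((ContinuousLinearMap.compL ℝ E (E [⋀^Fin n]→L[ℝ] ℝ) ℝ
      (ContinuousAlternatingMap.apply ℝ E ℝ (fun j ↦ (i.removeNth v j).1.1))).differentiableAt.comp p h1 :)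
  have hψ : DifferentiableAt ℝ (fun q : JetModel E F ↦ (v i).1.2 - q.2 (v i).1.1) p := by
    fun_prop
  exact ((ContinuousLinearMap.smulRightL ℝ E F).differentiableAt.comp p hφ).clm_apply hψ

end JetBundle

end Noether

/-! ### The covariant momentum map and its differential -/

section MomentumMap

variable {E : Type*} [NormedAddCommGroup E] [NormedSpace ℝ E]
  {F : Type*} [NormedAddCommGroup F] [NormedSpace ℝ F]
  {X : Type*} [TopologicalSpace X] [ChartedSpace E X]
  {Y : Type*} [TopologicalSpace Y] [ChartedSpace (E × F) Y]
  {π : Y → X}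
  {hπ : IsSubmersionOfComplement F 𝓘(ℝ, E × F) 𝓘(ℝ, E) ∞ π}
  [IsManifold 𝓘(ℝ, E) ∞ X] [IsManifold 𝓘(ℝ, E × F) ∞ Y]
  {EG : Type*} [NormedAddCommGroup EG] [NormedSpace ℝ EG]
  {G : Type*} [TopologicalSpace G] [ChartedSpace EG G] [Group G] [MulAction G Y]
  [IsManifold 𝓘(ℝ, EG) ∞ G]

namespace JetBundle

/-- The derivative of the induced coordinate system. -/
noncomputable abbrev dJet (c : AdaptedChart (E := E) (F := F) π)
    (hne : Nonempty (JetBundle hπ)) (z : JetBundle hπ) : JetModel E F →L[ℝ] JetModel E F :=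
  mfderiv 𝓘(ℝ, JetModel E F) 𝓘(ℝ, JetModel E F) (jetHomeo c hne) z

theorem dJetSymm_dJet (c : AdaptedChart (E := E) (F := F) π) (hne : Nonempty (JetBundle hπ))
    {p : JetModel E F} (hp : p ∈ (jetHomeo c hne).target) (v : JetModel E F) :
    dJetSymm c hne p (dJet c hne ((jetHomeo c hne).symm p) v) = v := by
  have h := (mdifferentiable_jetHomeo c hne).symm_comp_deriv ((jetHomeo c hne).map_target hp)
  rw [(jetHomeo c hne).right_inv hp] at h
  exact DFunLike.congr_fun h v

section

variable (κ : OpenPartialHomeomorph G EG) (hκ : κ ∈ IsManifold.maximalAtlas 𝓘(ℝ, EG) ∞ G)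
  (c : AdaptedChart (E := E) (F := F) π) (hne : Nonempty (JetBundle hπ))

/-- The domain of the coordinate expression of the prolonged action. -/
def prolongCoordDomain (κ : OpenPartialHomeomorph G EG) (c : AdaptedChart (E := E) (F := F) π) :
    Set (EG × JetModel E F) :=
  (fun r : EG × JetModel E F ↦ (r.1, r.2.1)) ⁻¹' actionCoordDomain κ c c

include hκ in
theorem isOpen_prolongCoordDomain (hG : IsBundleAction EG G hπ) :
    IsOpen (prolongCoordDomain (E := E) (F := F) κ c) :=
  (isOpen_actionCoordDomain hκ c c hG).preimage (by fun_prop)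

include hκ in
theorem prolongCoord_eq (hG : IsBundleAction EG G hπ) {r : EG × JetModel E F}
    (hr : r ∈ prolongCoordDomain κ c) :
    prolongCoord κ c c r = jetHomeo c hne
      (prolongedAction hG (κ.symm r.1) ((jetHomeo c hne).symm r.2)) := by
  have hr2 : r.2 ∈ (jetHomeo c hne).target := mem_jetHomeo_target.2 hr.1.2
  rw [jetHomeo_prolongedAction hκ c c hne hG (κ.map_target hr.1.1)
    (z := (jetHomeo c hne).symm r.2) ((jetHomeo c hne).map_target hr2) (by
      rw [jetHomeo_symm_pt c hne hr.1.2]; exact hr.2), κ.right_inv hr.1.1,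
    (jetHomeo c hne).right_inv hr2]

/-- Near the identity of `G` a single adapted chart serves for a point and its translates, so the
action becomes a family of local self-maps of the model space. -/
theorem mem_prolongCoordDomain_one (h1 : (1 : G) ∈ κ.source) {p : JetModel E F}
    (hp : p ∈ (jetHomeo c hne).target) : (κ 1, p) ∈ prolongCoordDomain κ c := by
  have hp1 := mem_jetHomeo_target.1 hp
  refine ⟨⟨κ.map_source h1, hp1⟩, ?_⟩
  change κ.symm (κ 1) • c.total.symm p.1 ∈ c.total.source
  rw [κ.left_inv h1, one_smul]
  exact c.total.map_target hp1

include hκ in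
theorem differentiableAt_prolongCoord (hG : IsBundleAction EG G hπ) {r : EG × JetModel E F}
    (hr : r ∈ prolongCoordDomain κ c) : DifferentiableAt ℝ (prolongCoord κ c c) r :=
  ((contDiffOn_prolongCoord hκ c c hG).contDiffAt
    ((isOpen_prolongCoordDomain κ hκ c hG).mem_nhds hr)).differentiableAt (by simp)

include hκ in
-- Matches the generator of the coordinate family, as it enters `extDeriv_curryLeft_of_invariant`,
-- with `ξ^(1)` read in the chart.
theorem fderiv_prolongCoord_generator (hG : IsBundleAction EG G hπ) (h1 : (1 : G) ∈ κ.source)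
    {p : JetModel E F} (hp : p ∈ (jetHomeo c hne).target)
    (ξ : GroupLieAlgebra 𝓘(ℝ, EG) G) :
    fderiv ℝ (prolongCoord κ c c) (κ 1, p)
      ((mfderiv 𝓘(ℝ, EG) 𝓘(ℝ, EG) κ (1 : G) : EG →L[ℝ] EG) ξ, 0) =
      dJet c hne ((jetHomeo c hne).symm p) (generator hG ξ ((jetHomeo c hne).symm p)) := by
  have hr := mem_prolongCoordDomain_one κ c hne h1 hp
  have hd := differentiableAt_prolongCoord κ hκ c hG hr
  have hκ1 : MDifferentiableAt 𝓘(ℝ, EG) 𝓘(ℝ, EG) κ (1 : G) :=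
    ((contMDiffOn_of_mem_maximalAtlas hκ).contMDiffAt
      (κ.open_source.mem_nhds h1)).mdifferentiableAt (by simp)
  have e1 : HasMFDerivAt 𝓘(ℝ, EG) 𝓘(ℝ, JetModel E F)
      ((fun s ↦ prolongCoord κ c c (s, p)) ∘ κ) (1 : G)
      ((fderiv ℝ (prolongCoord κ c c) (κ 1, p) ∘L ContinuousLinearMap.inl ℝ EG (JetModel E F)) ∘L
        (mfderiv 𝓘(ℝ, EG) 𝓘(ℝ, EG) κ (1 : G) : EG →L[ℝ] EG)) :=
    HasMFDerivAt.comp (I' := 𝓘(ℝ, EG)) (1 : G)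
      (HasFDerivAt.comp (κ 1) (g := prolongCoord κ c c) hd.hasFDerivAt
        (hasFDerivAt_prodMk_left (κ 1) p)).hasMFDerivAt hκ1.hasMFDerivAt
  have hw : (jetHomeo c hne).symm p ∈ (jetHomeo c hne).source := (jetHomeo c hne).map_target hp
  have e2 : HasMFDerivAt 𝓘(ℝ, EG) 𝓘(ℝ, JetModel E F)
      (jetHomeo c hne ∘ fun g : G ↦ prolongedAction hG g ((jetHomeo c hne).symm p)) (1 : G)
      (dJet c hne ((jetHomeo c hne).symm p) ∘L
        (mfderiv 𝓘(ℝ, EG) 𝓘(ℝ, JetModel E F)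
          (fun g : G ↦ prolongedAction hG g ((jetHomeo c hne).symm p)) 1 :
            EG →L[ℝ] JetModel E F)) := by
    have h3 := (mdifferentiable_orbit hG ((jetHomeo c hne).symm p) 1).hasMFDerivAt
    have h4 := ((mdifferentiable_jetHomeo c hne).mdifferentiableAt hw).hasMFDerivAt
    rw [← prolongedAction_one hG ((jetHomeo c hne).symm p)] at h4
    have h5 := HasMFDerivAt.comp (I' := 𝓘(ℝ, JetModel E F)) (1 : G) h4 h3
    rw [prolongedAction_one] at h5
    exact h5
  have e3 : (fun s ↦ prolongCoord κ c c (s, p)) ∘ κ =ᶠ[𝓝 1]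
      jetHomeo c hne ∘ fun g : G ↦ prolongedAction hG g ((jetHomeo c hne).symm p) := by
    have hc : ContinuousAt (fun g : G ↦ (κ g, p)) 1 :=
      (κ.continuousAt h1).prodMk continuousAt_const
    filter_upwards [κ.open_source.mem_nhds h1,
      hc.preimage_mem_nhds ((isOpen_prolongCoordDomain κ hκ c hG).mem_nhds hr)] with g hg hg'
    simp only [Function.comp_apply]
    rw [prolongCoord_eq κ hκ c hne hG hg', κ.left_inv hg]
  exact DFunLike.congr_fun (hasMFDerivAt_unique e1 (e2.congr_of_eventuallyEq e3)) ξ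

include hκ in
/-- In coordinates, the prolonged action preserves every invariant form. -/
theorem compContinuousLinearMap_prolongCoord (hG : IsBundleAction EG G hπ) {k : ℕ}
    {α : DiffForm (JetModel E F) (JetBundle hπ) k}
    (hα : ∀ g : G, DiffForm.pullback (prolongedAction hG g) α = α) {r : EG × JetModel E F}
    (hr : r ∈ prolongCoordDomain κ c) :
    ((DiffForm.pullback (jetHomeo c hne).symm α : DiffForm (JetModel E F) (JetModel E F) k)
      (prolongCoord κ c c r)).compContinuousLinearMap
        (fderiv ℝ (prolongCoord κ c c) r ∘L ContinuousLinearMap.inr ℝ EG (JetModel E F)) =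
      (DiffForm.pullback (jetHomeo c hne).symm α : DiffForm (JetModel E F) (JetModel E F) k)
        r.2 := by
  obtain ⟨s, p⟩ := r
  have hp : p ∈ (jetHomeo c hne).target := mem_jetHomeo_target.2 hr.1.2
  have hχ := mdifferentiable_jetHomeo c hne
  have h1 : HasFDerivAt (fun q ↦ prolongCoord κ c c (s, q))
      (fderiv ℝ (prolongCoord κ c c) (s, p) ∘L ContinuousLinearMap.inr ℝ EG (JetModel E F)) p :=
    (differentiableAt_prolongCoord κ hκ c hG hr).hasFDerivAt.comp p (hasFDerivAt_prodMk_right s p)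
  have h2 : ∀ᶠ q in 𝓝 p, (s, q) ∈ prolongCoordDomain κ c :=
    (hasFDerivAt_prodMk_right (𝕜 := ℝ) s p).continuousAt.preimage_mem_nhds
      ((isOpen_prolongCoordDomain κ hκ c hG).mem_nhds hr)
  -- The chart intertwines the coordinate family with the prolonged action, so invariance transfers
  -- by functoriality of pullback.
  have h3 : (jetHomeo c hne).symm ∘ (fun q ↦ prolongCoord κ c c (s, q)) =ᶠ[𝓝 p]
      prolongedAction hG (κ.symm s) ∘ (jetHomeo c hne).symm := by
    filter_upwards [h2] with q hq
    have hq' : prolongedAction hG (κ.symm s) ((jetHomeo c hne).symm q) ∈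
        (jetHomeo c hne).source := by
      change κ.symm s • ((jetHomeo c hne).symm q).pt ∈ c.total.source
      rw [jetHomeo_symm_pt c hne hq.1.2]
      exact hq.2
    simp only [Function.comp_apply]
    rw [prolongCoord_eq κ hκ c hne hG hq, (jetHomeo c hne).left_inv hq']
  have hmem : prolongCoord κ c c (s, p) ∈ (jetHomeo c hne).target := by
    rw [prolongCoord_eq κ hκ c hne hG hr]
    refine (jetHomeo c hne).map_source ?_
    change κ.symm s • ((jetHomeo c hne).symm p).pt ∈ c.total.source
    rw [jetHomeo_symm_pt c hne hr.1.2]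
    exact hr.2
  rw [← h1.fderiv, ← DiffForm.pullback_model (fun q ↦ prolongCoord κ c c (s, q)),
    ← DiffForm.pullback_comp (f := fun q ↦ prolongCoord κ c c (s, q)) α
      (hχ.mdifferentiableAt_symm hmem)
      h1.differentiableAt.mdifferentiableAt, DiffForm.pullback_congr α h3,
    DiffForm.pullback_comp α (mdifferentiable_prolongedAction hG _ _)
      (hχ.mdifferentiableAt_symm hp), hα]

end

variable [FiniteDimensional ℝ E] [FiniteDimensional ℝ F]

/-- The momentum map is differentiable, and `dJ_ξ = i_{ξ^(1)} Ω_L`. -/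
theorem d_momentumMap {n : ℕ} {μ : DiffForm E X (n + 1)} (hμ : μ.IsSmooth)
    {L : JetBundle hπ → ℝ} (hL : ContMDiff 𝓘(ℝ, JetModel E F) 𝓘(ℝ, ℝ) ∞ L)
    (hG : IsBundleAction EG G hπ) (hLG : ∀ (g : G) z, L (prolongedAction hG g z) = L z)
    (ξ : GroupLieAlgebra 𝓘(ℝ, EG) G) (z : JetBundle hπ) :
    DifferentiableAt ℝ (DiffForm.pullback (chartAt (JetModel E F) z).symm (momentumMap μ L hG ξ) :
        DiffForm (JetModel E F) (JetModel E F) n) (chartAt (JetModel E F) z z) ∧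
      DiffForm.d (momentumMap μ L hG ξ) z =
        DiffForm.contract (generator hG ξ) (multisymplecticForm μ L) z := by
  have hzs := mem_chart_source (JetModel E F) z
  simp only [multisymplecticForm, DiffForm.contract, Pi.neg_apply, DiffForm.d]
  obtain ⟨c, hne, hc⟩ := exists_chartAt_eq_jetHomeo z
  rw [hc] at hzs ⊢
  let κ := chartAt EG (1 : G)
  have hκ : κ ∈ IsManifold.maximalAtlas 𝓘(ℝ, EG) ∞ G := IsManifold.chart_mem_maximalAtlas 1
  have h1 : (1 : G) ∈ κ.source := mem_chart_source EG 1
  have hp := (jetHomeo c hne).map_source hzs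
  have hmem := mem_prolongCoordDomain_one κ c hne h1 hp
  have hopen := (isOpen_prolongCoordDomain κ hκ c hG).mem_nhds hmem
  have hinv (g : G) := pullback_prolongedAction_cartanForm hG (hL.mdifferentiable (by simp)) g
    (hLG g) μ
  have hs : ∀ᶠ s in 𝓝 (κ 1), (s, jetHomeo c hne z) ∈ prolongCoordDomain κ c :=
    (hasFDerivAt_prodMk_left (𝕜 := ℝ) (κ 1) (jetHomeo c hne z)).continuousAt.preimage_mem_nhds hopen
  let a : EG := (mfderiv 𝓘(ℝ, EG) 𝓘(ℝ, EG) κ (1 : G) : EG →L[ℝ] EG) ξ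
  -- Cartan's formula with parameter space `EG`, base parameter `κ 1` and direction `a`, the image
  -- of `ξ` in the chart of `G`.
  obtain ⟨hJ, hdJ⟩ := extDeriv_curryLeft_of_invariant
    (differentiableAt_cartanForm c hne hμ hL hp)
    (((contDiffOn_prolongCoord hκ c c hG).contDiffAt hopen).of_le (by norm_cast))
    (by
      filter_upwards [(jetHomeo c hne).open_target.mem_nhds hp] with q hq
      rw [prolongCoord_eq κ hκ c hne hG (mem_prolongCoordDomain_one κ c hne h1 hq)]
      simp only [κ.left_inv h1, prolongedAction_one, (jetHomeo c hne).right_inv hq])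
    (by
      filter_upwards [hs] with s hs
      exact compContinuousLinearMap_prolongCoord κ hκ c hne hG hinv hs) a
  have heq : (DiffForm.pullback (jetHomeo c hne).symm (momentumMap μ L hG ξ) :
        DiffForm (JetModel E F) (JetModel E F) n) =ᶠ[𝓝 (jetHomeo c hne z)] fun p ↦
      ((DiffForm.pullback (jetHomeo c hne).symm (cartanForm μ L) :
        DiffForm (JetModel E F) (JetModel E F) (n + 1)) p).curryLeft
          (fderiv ℝ (prolongCoord κ c c) (κ 1, p) (a, 0)) := by
    filter_upwards [(jetHomeo c hne).open_target.mem_nhds hp] with q hq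
    ext v
    rw [fderiv_prolongCoord_generator κ hκ c hne hG h1 hq]
    refine congrArg (cartanForm μ L ((jetHomeo c hne).symm q)) (funext fun i ↦ ?_)
    refine Fin.cases ?_ (fun i ↦ rfl) i
    exact (dJetSymm_dJet c hne hq _).symm
  refine ⟨heq.differentiableAt_iff.2 hJ, ?_⟩
  rw [fderiv_prolongCoord_generator κ hκ c hne hG h1 hp, (jetHomeo c hne).left_inv hzs] at hdJ
  simp only [DiffForm.pullback]
  change ContinuousAlternatingMap.compContinuousLinearMap (extDeriv (DiffForm.pullback
    (jetHomeo c hne).symm (momentumMap μ L hG ξ) :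
        DiffForm (JetModel E F) (JetModel E F) n) (jetHomeo c hne z)) (dJet c hne z) = _
  rw [heq.extDeriv_eq, hdJ]
  ext v
  refine congrArg Neg.neg (congrArg (extDeriv (DiffForm.pullback (jetHomeo c hne).symm
    (cartanForm μ L) : DiffForm (JetModel E F) (JetModel E F) (n + 1)) (jetHomeo c hne z))
      (funext fun i ↦ ?_))
  exact Fin.cases rfl (fun i ↦ rfl) i

end JetBundle

end MomentumMap

/-! ### The Noether theorem -/

/-- By idempotence `h v - v` lies in the kernel of `h`, that is, it is vertical. -/
theorem JetBundle.IsHorizontalProjector.sourceDeriv_apply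
    {E : Type*} [NormedAddCommGroup E] [NormedSpace ℝ E]
    {F : Type*} [NormedAddCommGroup F] [NormedSpace ℝ F]
    {X : Type*} [TopologicalSpace X] [ChartedSpace E X] [IsManifold 𝓘(ℝ, E) ∞ X]
    {Y : Type*} [TopologicalSpace Y] [ChartedSpace (E × F) Y] [IsManifold 𝓘(ℝ, E × F) ∞ Y]
    {π : Y → X} {hπ : IsSubmersionOfComplement F 𝓘(ℝ, E × F) 𝓘(ℝ, E) ∞ π}
    {h : VectorOneForm (JetModel E F) (JetBundle hπ)} (hh : IsHorizontalProjector h)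
    (z : JetBundle hπ) (v : JetModel E F) : sourceDeriv z (h z v) = sourceDeriv z v := by
  have h1 : h z (h z v - v) = 0 := by
    rw [map_sub, sub_eq_zero]
    exact DFunLike.congr_fun (hh.idempotent z) v
  have h2 := (hh.ker_eq z _).1 h1
  rwa [map_sub, sub_eq_zero] at h2

theorem mainTheorem2 {n : ℕ}
    {E : Type*} [NormedAddCommGroup E] [NormedSpace ℝ E] [FiniteDimensional ℝ E]
    (hE : Module.finrank ℝ E = n + 1)
    {F : Type*} [NormedAddCommGroup F] [NormedSpace ℝ F] [FiniteDimensional ℝ F]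
    {X : Type*} [TopologicalSpace X] [ChartedSpace E X] [IsManifold 𝓘(ℝ, E) ∞ X]
    {Y : Type*} [TopologicalSpace Y] [ChartedSpace (E × F) Y] [IsManifold 𝓘(ℝ, E × F) ∞ Y]
    {π : Y → X} (hπ : IsSubmersionOfComplement F 𝓘(ℝ, E × F) 𝓘(ℝ, E) ∞ π)
    (μ : DiffForm E X (n + 1)) (hμ : μ.IsSmooth) (hμ0 : ∀ x, μ x ≠ 0)
    {EG : Type*} [NormedAddCommGroup EG] [NormedSpace ℝ EG] [FiniteDimensional ℝ EG]
    {G : Type*} [TopologicalSpace G] [ChartedSpace EG G] [Group G] [LieGroup 𝓘(ℝ, EG) ∞ G]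
    [MulAction G Y] (hG : JetBundle.IsBundleAction EG G hπ)
    (L : JetBundle hπ → ℝ) (hL : ContMDiff 𝓘(ℝ, JetModel E F) 𝓘(ℝ, ℝ) ∞ L)
    (hLG : ∀ (g : G) (z : JetBundle hπ), L (JetBundle.prolongedAction hG g z) = L z)
    (h : VectorOneForm (JetModel E F) (JetBundle hπ)) (hh : JetBundle.IsHorizontalProjector h)
    (hDW : JetBundle.SolvesDeDonderWeyl μ L h) :
    ∀ ξ : GroupLieAlgebra 𝓘(ℝ, EG) G,
      DiffForm.dVec h (JetBundle.momentumMap μ L hG ξ) = 0 ∧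
      ∀ (U : Set X) (ψ : X → JetBundle hπ), JetBundle.IsIntegralSection h U ψ →
        ∀ x ∈ U, DiffForm.d (DiffForm.pullback ψ (JetBundle.momentumMap μ L hG ξ) :
          DiffForm E X n) x = 0 := by
  intro ξ
  have hvert (z : JetBundle hπ) := JetBundle.sourceDeriv_generator hG ξ z
  have haux (z : JetBundle hπ) := JetBundle.d_momentumMap hμ hL hG hLG ξ z
  -- `i_h dJ = n dJ`
  have hdJ (z : JetBundle hπ) :
      DiffForm.insertion h (DiffForm.d (JetBundle.momentumMap μ L hG ξ)) z =
        (n : ℝ) • DiffForm.d (JetBundle.momentumMap μ L hG ξ) z := by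
    have h1 : DiffForm.d (JetBundle.momentumMap μ L hG ξ) =
        DiffForm.contract (JetBundle.generator hG ξ) (JetBundle.multisymplecticForm μ L) :=
      funext fun z ↦ (haux z).2
    rw [h1, DiffForm.insertion_contract h _ _ ((hh.ker_eq z _).2 (hvert z)), hDW]
    rfl
  -- `i_h J = n J`
  have hJ : DiffForm.insertion h (JetBundle.momentumMap μ L hG ξ) =
      (n : ℝ) • JetBundle.momentumMap μ L hG ξ := by
    funext z
    refine DiffForm.insertion_eq_smul h _ fun v i ↦ ?_
    change JetBundle.cartanForm μ L z (Matrix.vecCons _ _) =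
      JetBundle.cartanForm μ L z (Matrix.vecCons _ _)
    rw [JetBundle.cartanForm_cons_of_vertical μ L (hvert z),
      JetBundle.cartanForm_cons_of_vertical μ L (hvert z)]
    refine JetBundle.momentumForm_congr μ L _ fun j ↦ ?_
    by_cases hj : j = i
    · subst hj
      rw [Function.update_self, hh.sourceDeriv_apply]
    · rw [Function.update_of_ne hj]
  refine ⟨?_, fun U ψ hψ x hx ↦ ?_⟩
  · rw [DiffForm.dVec, hJ, DiffForm.d_smul]
    funext z
    rw [Pi.sub_apply, hdJ, Pi.smul_apply, sub_self]
    rfl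
  · rw [DiffForm.d_pullback hψ.isOpen hψ.smooth hx (haux (ψ x)).1]
    ext v
    let w : Fin (n + 1) → JetModel E F :=
      fun i ↦ (mfderiv 𝓘(ℝ, E) 𝓘(ℝ, JetModel E F) ψ x : E →L[ℝ] JetModel E F) (v i)
    have h1 := DFunLike.congr_fun (hdJ (ψ x)) w
    rw [DiffForm.insertion_apply] at h1
    -- Each of the `n + 1` terms of `i_h dJ` equals `dJ` on tangent vectors of the section, so `(n +
    -- 1) dJ = n dJ` there.
    have h2 (i : Fin (n + 1)) : Function.update w i (h (ψ x) (w i)) = w := by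
      rw [show h (ψ x) (w i) = w i from hψ.horizontal x hx (v i), Function.update_eq_self]
    simp only [h2, Finset.sum_const, Finset.card_univ, Fintype.card_fin, nsmul_eq_mul,
      ContinuousAlternatingMap.smul_apply, smul_eq_mul] at h1
    push_cast at h1
    change DiffForm.d (JetBundle.momentumMap μ L hG ξ) (ψ x) w = 0
    linarith
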